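/- **The game.** Fix $T>0$, intervals $U^1,U^2\subseteq\mathbb R$, and $C^2$ functions $L_{io}:U^i\to\mathbb R$, $L_{ir}:U^j\to\mathbb R$ ($j\ne i$), $B^i:(0,\infty)\to\mathbb R$, $i=1,2$, with $L_{io}'>0$ and $L_{io}''<0$ in the interior of $U^i$. Player $i$ maximizes $\int_t^T \big(L_{io}(u^i)+L_{ir}(u^j)\big)\,ds+B^i(y(T))$ (no discounting), where $\dot y=F(u)=-(u^1+u^2)$, $y(t)=x>0$. A profile of feedback rules $u=(u^1,u^2)$ of class $C^1$ on $[0,T]\times(0,\infty)$ with $u^i(t,x)\in U^i$ is admissible for a dynamics if, from every initial node $(t,x)\in[0,T]\times(0,\infty)$, the state equation has a unique solution on $[t,T]$ with values in $(0,\infty)$. A Markov perfect Nash equilibrium (MPNE) is a profile admissible for $F$ against which, from every initial node, no player gains by a unilateral deviation to a rule for which the resulting profile is admissible. Put $$E_i(u^i)=-\frac{L_{io}'(u^i)}{L_{io}''(u^i)},\qquad E_{ij}(u^i,u^j)=-\frac{L_{ir}'(u^j)}{L_{io}''(u^i)}.$$ **Monopoly models.** A model is a triple $(\ell,f,b)$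 with $\ell,f:U^1\times U^2\to\mathbb R$ and $b:(0,\infty)\to\mathbb R$ of class $C^2$: a single agent chooses $(u^1,u^2)$ to maximize $\int_t^T\ell(u)\,ds+b(z(T))$ subject to $\dot z=f(u)$, $z(t)=x$. It rationalizes $u$ if $u$ is an MPNE of the game, is admissible for $f$, and from every initial node $u$ is optimal in the control problem among the profiles admissible for both $F$ and $f$. With $\gamma^i=-\ell_{u^i}/f_{u^i}$, the model is called regular along $u$ if $f_{u^1}\neq0$, $f_{u^2}\ne0$ and $\partial(\gamma^1-\gamma^2)/\partial u^2\neq0$ at all the points $u(t,x)$, $(t,x)\in[0,T]\times(0,\infty)$. **Proposition.** Let $u=(u^1,u^2)$ be an MPNE of the game with $u^i(t,x)$ in the interior of $U^i$ and $u^1_x(t,x)\neq 0$ for all $(t,x)\in[0,T]\times(0,\infty)$. (a) If some monopoly model $(\ell,f,b)$, regular along $u$, rationalizes $u$, then $(E_1-E_{12})(E_2-E_{21})\ge0$ at $u(t,x)$ for all $(t,x)\in[0,T]\times(0,\infty)$. If this inequality is strict for all $(t,x)$, there is a function $\theta$ such that: * $u^2(t,x)=\theta(u^1(t,x))$ for all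 $(t,x)$, and $\theta$ satisfies, on the range of $u^1$, one of the two ODEs $$\theta'(w)=\pm\frac{\sqrt{|E_2(\theta(w))-E_{21}(\theta(w),w)|}}{\sqrt{|E_1(w)-E_{12}(w,\theta(w))|}}$$ with a fixed sign; * with a fixed sign, $f=F\pm\sqrt{(E_1-E_{12})(E_2-E_{21})}$ at $u(t,x)$, for every $(t,x)$ at which the costate of the monopolist genuinely depends on the stock, i.e. $\partial_x\big[\gamma^1(u(t,x))\big]\ne0$; * for every $x>0$ and $i=1,2$, $B^i_x(x)$ lies in the range of $L_{io}'$ on the interior of $U^i$, and $$\big((L_{2o}')^{-1}\circ B^2_x\big)(x)=\big(\theta\circ(L_{1o}')^{-1}\circ B^1_x\big)(x).$$ (b) If $(E_1-E_{12})(E_2-E_{21})<0$ at $u(t,x)$ for some $(t,x)\in[0,T]\times(0,\infty)$, then no monopoly model that is regular along $u$ rationalizes $u$. -/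

import Mathlib

open Set

/-- Extraction rates of the two oligopolists (index `0` is player 1, index `1` is player 2). -/
abbrev Controls : Type := Fin 2 → ℝ

/-- A profile of Markov feedback rules: `φ i t x` is the extraction rate of player `i` at time `t`
when the stock is `x`. -/
abbrev FeedbackProfile : Type := Fin 2 → ℝ → ℝ → ℝ

/-- The controls that a feedback profile prescribes at the node `(t, x)`. -/
def FeedbackProfile.at (φ : FeedbackProfile) (t x : ℝ) : Controls := fun i => φ i t x

/-- `y` solves `y' = g (u)` on `[t, T]` with `y t = x`, where `u` is generated by the feedback
profile `φ`; the stock `y` stays in the state space `(0, ∞)`. -/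
def IsTrajectory (g : Controls → ℝ) (T : ℝ) (φ : FeedbackProfile) (t x : ℝ) (y : ℝ → ℝ) : Prop :=
  y t = x ∧
    ∀ s ∈ Icc t T, 0 < y s ∧ HasDerivWithinAt y (g (φ.at s (y s))) (Icc t T) s

/-- Admissible feedback profiles for the dynamics `g`: class `C¹` on `[0, T] × (0, ∞)`, values in
the control regions, and a unique trajectory from every initial node. -/
def IsAdmissible (g : Controls → ℝ) (T : ℝ) (U : Fin 2 → Set ℝ) (φ : FeedbackProfile) : Prop :=
  (∀ i, ContDiffOn ℝ 1 (fun p : ℝ × ℝ => φ i p.1 p.2) (Icc 0 T ×ˢ Ioi 0)) ∧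
  (∀ i, ∀ t ∈ Icc 0 T, ∀ x ∈ Ioi (0 : ℝ), φ i t x ∈ U i) ∧
  (∀ t ∈ Icc 0 T, ∀ x ∈ Ioi (0 : ℝ), ∃ y, IsTrajectory g T φ t x y ∧
    ∀ y', IsTrajectory g T φ t x y' → EqOn y' y (Icc t T))

/-- Undiscounted payoff collected on `[t, T]` along the state path `y` generated by `φ`:
running utility `L` plus bequest `B` at the final stock. -/
noncomputable def payoffAlong (L : Controls → ℝ) (B : ℝ → ℝ) (T : ℝ) (φ : FeedbackProfile)
    (t : ℝ) (y : ℝ → ℝ) : ℝ :=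
  (∫ s in t..T, L (φ.at s (y s))) + B (y T)

/-- The partial derivative of `g` with respect to the control of player `i`. -/
noncomputable def partialDeriv (g : Controls → ℝ) (i : Fin 2) (u : Controls) : ℝ :=
  deriv (fun w => g (Function.update u i w)) (u i)

/-- The data of a two-person nonrenewable resource game with additive externalities, finite
horizon `T` and zero discount. Player `i` has utility
`own i (u i) + ext i (u j)`, where `j = 1 - i` is the rival, and bequest function `bequest i`. -/
structure AdditiveDuopoly where
  T : ℝ
  T_pos : 0 < T
  U : Fin 2 → Set ℝ
  own : Fin 2 → ℝ → ℝ
  ext : Fin 2 → ℝ → ℝ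
  bequest : Fin 2 → ℝ → ℝ
  convex_U : ∀ i, Convex ℝ (U i)
  own_smooth : ∀ i, ContDiffOn ℝ 2 (own i) (U i)
  ext_smooth : ∀ i, ContDiffOn ℝ 2 (ext i) (U (1 - i))
  bequest_smooth : ∀ i, ContDiffOn ℝ 2 (bequest i) (Ioi 0)
  own_increasing : ∀ i, ∀ w ∈ interior (U i), 0 < deriv (own i) w
  own_concave : ∀ i, ∀ w ∈ interior (U i), deriv (deriv (own i)) w < 0

namespace AdditiveDuopoly

/-- The utility `L^i` of player `i`. -/
def utility (G : AdditiveDuopoly) (i : Fin 2) (u : Controls) : ℝ :=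
  G.own i (u i) + G.ext i (u (1 - i))

/-- The dynamics `F` of the resource: `y' = -(u¹ + u²)`. -/
def dynamics (_G : AdditiveDuopoly) (u : Controls) : ℝ := -∑ j, u j

/-- Markov perfect Nash equilibrium: from no initial node does a unilateral deviation to an
admissible feedback rule pay. -/
def IsMPNE (G : AdditiveDuopoly) (φ : FeedbackProfile) : Prop :=
  IsAdmissible G.dynamics G.T G.U φ ∧
  ∀ i, ∀ v : ℝ → ℝ → ℝ, IsAdmissible G.dynamics G.T G.U (Function.update φ i v) →
    ∀ t ∈ Icc 0 G.T, ∀ x ∈ Ioi (0 : ℝ), ∀ y y' : ℝ → ℝ,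
      IsTrajectory G.dynamics G.T φ t x y →
      IsTrajectory G.dynamics G.T (Function.update φ i v) t x y' →
      payoffAlong (G.utility i) (G.bequest i) G.T (Function.update φ i v) t y' ≤
        payoffAlong (G.utility i) (G.bequest i) G.T φ t y

/-- `E_i(u^i) = - L_{io}'(u^i) / L_{io}''(u^i)`. -/
noncomputable def E (G : AdditiveDuopoly) (i : Fin 2) (u : Controls) : ℝ :=
  -(deriv (G.own i) (u i) / deriv (deriv (G.own i)) (u i))

/-- `E_{ij}(u^i, u^j) = - L_{ir}'(u^j) / L_{io}''(u^i)`, where `j = 1 - i`. -/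
noncomputable def Eext (G : AdditiveDuopoly) (i : Fin 2) (u : Controls) : ℝ :=
  -(deriv (G.ext i) (u (1 - i)) / deriv (deriv (G.own i)) (u i))

/-- `(E_1 - E_12) (E_2 - E_21)`. -/
noncomputable def product (G : AdditiveDuopoly) (u : Controls) : ℝ :=
  (G.E 0 u - G.Eext 0 u) * (G.E 1 u - G.Eext 1 u)

/-- The inverse function `(L_{io}')⁻¹` of the marginal utility from own consumption. -/
noncomputable def marginalInv (G : AdditiveDuopoly) (i : Fin 2) : ℝ → ℝ :=
  Function.invFunOn (deriv (G.own i)) (interior (G.U i))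

end AdditiveDuopoly

/-- An undiscounted monopolistic resource model with the horizon and control regions of `G`:
one agent chooses both controls; payoff integrand, dynamics and bequest function are free, of class
`C²`, and (as in the game) the first two depend on the controls only. -/
structure MonopolyModel (G : AdditiveDuopoly) where
  payoff : Controls → ℝ
  dynamics : Controls → ℝ
  bequest : ℝ → ℝ
  payoff_smooth : ContDiffOn ℝ 2 payoff (univ.pi G.U)
  dynamics_smooth : ContDiffOn ℝ 2 dynamics (univ.pi G.U)
  bequest_smooth : ContDiffOn ℝ 2 bequest (Ioi 0)

namespace MonopolyModel

variable {G : AdditiveDuopoly}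

/-- `φ` solves the control problem: from every initial node it does at least as well as every
profile of the game's feasible set for which the controlled dynamics are well posed. -/
def IsOptimal (M : MonopolyModel G) (φ : FeedbackProfile) : Prop :=
  IsAdmissible M.dynamics G.T G.U φ ∧
  ∀ ψ : FeedbackProfile, IsAdmissible G.dynamics G.T G.U ψ →
    IsAdmissible M.dynamics G.T G.U ψ →
    ∀ t ∈ Icc 0 G.T, ∀ x ∈ Ioi (0 : ℝ), ∀ z z' : ℝ → ℝ,
      IsTrajectory M.dynamics G.T φ t x z →
      IsTrajectory M.dynamics G.T ψ t x z' →
      payoffAlong M.payoff M.bequest G.T ψ t z' ≤ payoffAlong M.payoff M.bequest G.T φ t z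

/-- `M` rationalizes `φ`: the profile `φ` solves both the game and the control problem. -/
def Rationalizes (M : MonopolyModel G) (φ : FeedbackProfile) : Prop :=
  G.IsMPNE φ ∧ M.IsOptimal φ

/-- The costate function `γ^i = - ℓ_{u^i} / f_{u^i}`. -/
noncomputable def costate (M : MonopolyModel G) (i : Fin 2) (u : Controls) : ℝ :=
  -(partialDeriv M.payoff i u / partialDeriv M.dynamics i u)

/-- Nondegeneracy along `φ`: the costates `γ¹`, `γ²` are defined there, `f_{u^i} ≠ 0`, and the
relation `γ¹ = γ²` can be solved locally for `u²`, that is `∂(γ¹ - γ²)/∂u² ≠ 0`. -/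
def IsRegularAlong (M : MonopolyModel G) (φ : FeedbackProfile) : Prop :=
  ∀ t ∈ Icc 0 G.T, ∀ x ∈ Ioi (0 : ℝ),
    (∀ i, partialDeriv M.dynamics i (φ.at t x) ≠ 0) ∧
    partialDeriv (fun u => M.costate 0 u - M.costate 1 u) 1 (φ.at t x) ≠ 0

end MonopolyModel

open Filter Topology Metric
open scoped NNReal ContDiff

/-! Write e_i for E_i - E_ij along u. Perturb the stock path y of an equilibrium to y + εη through
player i's own control, while the rival keeps his feedback rule and so reacts to the new stock. The
vanishing first variation gives an Euler–Lagrange equation which, divided by L_io'', reads u^i_t + F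
u^i_x + e_i u^j_x = 0 (`equilibrium_system`), together with L_io'(u^i(T, x)) = B^i_x(x)
(`transversality`). Since the monopolist's payoff integrand and dynamics do not involve the stock,
his costate is constant along each trajectory of f, equal to the marginal bequest at its end
(`monopoly_stationary`). Hence γ¹ = γ² at every node, and γ¹_t + f γ¹_x = 0 (`costate_relations`).

Differentiating γ¹ - γ² = 0 in t and x, with nonzero derivative in u², gives u²_t = τ u¹_t and u²_x
= τ u¹_x with one and the same τ. Eliminating u¹_t from the equilibrium system leaves e_1 τ² = e_2,
so e_1 e_2 = (e_1 τ)² ≥ 0, which proves the inequality in (a) and, by contraposition, (b). Where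
γ¹_x ≠ 0, comparing the two transport equations gives f = F + e_1 τ (`slope_relations`). If the
inequality is strict, τ and e_1 τ vanish nowhere, and connectedness of the set of nodes fixes their
signs.

Two points need care. A deviation has to be a globally admissible feedback rule, for f as well in
the monopolist's problem; it is obtained by changing the rules only for stocks in a compact
interval, which preserves well-posedness (`exists_deviation`, `WellPosed.of_eq_off`). And θ must be
a single function although the implicit function theorem is local: the range of u is connected, and
its projection to the u¹-axis is locally injective with local sections, hence injective
(`injective_of_local_sections`). -/

/-- The space of nodes `(t, x)` of a problem with horizon `T`. -/
abbrev nodes (T : ℝ) : Set (ℝ × ℝ) := Icc 0 T ×ˢ Ioi 0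

/-- `y` solves `y' = Γ (s, y)` on `[t, T]` with `y t = x` and stays positive. -/
def SolvesField (Γ : ℝ → ℝ → ℝ) (T t x : ℝ) (y : ℝ → ℝ) : Prop :=
  y t = x ∧ ∀ s ∈ Icc t T, 0 < y s ∧ HasDerivWithinAt y (Γ s (y s)) (Icc t T) s

/-- Every initial node is the start of exactly one positive solution. -/
def WellPosed (Γ : ℝ → ℝ → ℝ) (T : ℝ) : Prop :=
  ∀ t ∈ Icc 0 T, ∀ x ∈ Ioi (0 : ℝ), ∃ y, SolvesField Γ T t x y ∧
    ∀ y', SolvesField Γ T t x y' → EqOn y' y (Icc t T)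

/-! ### Scalar differential equations on the set of nodes, and stability of well-posedness. -/

theorem uniqueDiffOn_nodes {T : ℝ} (hT : 0 < T) : UniqueDiffOn ℝ (nodes T) :=
  (uniqueDiffOn_Icc hT).prod isOpen_Ioi.uniqueDiffOn

theorem SolvesField.continuousOn {Γ : ℝ → ℝ → ℝ} {T t x : ℝ} {y : ℝ → ℝ}
    (h : SolvesField Γ T t x y) : ContinuousOn y (Icc t T) :=
  fun s hs => (h.2 s hs).2.continuousWithinAt

/-- A continuous positive path on a compact interval stays in a compact part of `(0, ∞)`. -/
theorem exists_pos_bounds {a b : ℝ} {y : ℝ → ℝ} (hy : ContinuousOn y (Icc a b))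
    (hpos : ∀ s ∈ Icc a b, 0 < y s) :
    ∃ m M, 0 < m ∧ m ≤ M ∧ ∀ s ∈ Icc a b, y s ∈ Icc m M := by
  rcases (Icc a b).eq_empty_or_nonempty with h | h
  · exact ⟨1, 1, one_pos, le_rfl, by simp [h]⟩
  · obtain ⟨p, hp, hpm⟩ := isCompact_Icc.exists_isMinOn h hy
    obtain ⟨q, hq, hqm⟩ := isCompact_Icc.exists_isMaxOn h hy
    exact ⟨y p, y q, hpos p hp, hpm hq, fun s hs => ⟨hpm hs, hqm hs⟩⟩

section Field

variable {Γ : ℝ → ℝ → ℝ} {T : ℝ}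

theorem lipschitzOnWith_of_contDiffOn (hT : 0 < T)
    (hΓ : ContDiffOn ℝ 1 (fun p : ℝ × ℝ => Γ p.1 p.2) (nodes T)) {m M : ℝ} (hm : 0 < m) :
    ∃ K : ℝ≥0, ∀ s ∈ Icc 0 T, LipschitzOnWith K (Γ s) (Icc m M) := by
  have hcont := hΓ.continuousOn_fderivWithin (uniqueDiffOn_nodes hT) le_rfl
  have hsub : Icc 0 T ×ˢ Icc m M ⊆ nodes T :=
    prod_mono le_rfl fun x hx => lt_of_lt_of_le hm hx.1
  obtain ⟨K, hK⟩ := (isCompact_Icc.prod isCompact_Icc).exists_bound_of_continuousOn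
    (hcont.mono hsub)
  refine ⟨Real.toNNReal K, fun s hs => ?_⟩
  have key : LipschitzOnWith (Real.toNNReal K) (fun p : ℝ × ℝ => Γ p.1 p.2)
      (Icc 0 T ×ˢ Icc m M) := by
    refine ((convex_Icc 0 T).prod (convex_Icc m M)).lipschitzOnWith_of_nnnorm_hasFDerivWithin_le
      (f' := fun p => fderivWithin ℝ (fun p : ℝ × ℝ => Γ p.1 p.2) (nodes T) p)
      (fun p hp => ?_) (fun p hp => ?_)
    · exact ((hΓ.differentiableOn one_ne_zero p (hsub hp)).hasFDerivWithinAt).mono hsub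
    · rw [← NNReal.coe_le_coe, coe_nnnorm]
      exact (hK p hp).trans (Real.le_coe_toNNReal K)
  intro x hx x' hx'
  have := key (x := (s, x)) ⟨hs, hx⟩ (y := (s, x')) ⟨hs, hx'⟩
  simpa [Prod.edist_eq] using this

/-- Both paths stay in a common compact stock interval, where the field is Lipschitz uniformly in
time, so Grönwall's inequality applies. -/
theorem SolvesField.eqOn (hT : 0 < T)
    (hΓ : ContDiffOn ℝ 1 (fun p : ℝ × ℝ => Γ p.1 p.2) (nodes T)) {t x : ℝ} (ht : 0 ≤ t)
    {y y' : ℝ → ℝ} (hy : SolvesField Γ T t x y) (hy' : SolvesField Γ T t x y') :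
    EqOn y y' (Icc t T) := by
  obtain ⟨m, M, hm, -, hb⟩ := exists_pos_bounds hy.continuousOn fun s hs => (hy.2 s hs).1
  obtain ⟨m', M', hm', -, hb'⟩ := exists_pos_bounds hy'.continuousOn fun s hs => (hy'.2 s hs).1
  obtain ⟨K, hK⟩ := lipschitzOnWith_of_contDiffOn hT hΓ (m := min m m') (M := max M M')
    (lt_min hm hm')
  have hd : ∀ {z : ℝ → ℝ}, SolvesField Γ T t x z → ∀ s ∈ Ico t T,
      HasDerivWithinAt z (Γ s (z s)) (Ici s) s := by
    intro z hz s hs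
    refine ((hz.2 s ⟨hs.1, hs.2.le⟩).2).mono_of_mem_nhdsWithin ?_
    exact mem_of_superset (Icc_mem_nhdsGE hs.2) (Icc_subset_Icc_left hs.1)
  refine ODE_solution_unique_of_mem_Icc_right (v := Γ) (K := K)
    (s := fun _ => Icc (min m m') (max M M'))
    (fun s hs => hK s ⟨ht.trans hs.1, hs.2.le⟩) hy.continuousOn (hd hy) (fun s hs => ?_)
    hy'.continuousOn (hd hy') (fun s hs => ?_) (hy.1.trans hy'.1.symm)
  · have := hb s ⟨hs.1, hs.2.le⟩
    exact ⟨(min_le_left _ _).trans this.1, this.2.trans (le_max_left _ _)⟩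
  · have := hb' s ⟨hs.1, hs.2.le⟩
    exact ⟨(min_le_right _ _).trans this.1, this.2.trans (le_max_right _ _)⟩

theorem exists_bound_field
    (hΓ : ContDiffOn ℝ 1 (fun p : ℝ × ℝ => Γ p.1 p.2) (nodes T)) {m M : ℝ} (hm : 0 < m) :
    ∃ C : ℝ≥0, ∀ s ∈ Icc 0 T, ∀ x ∈ Icc m M, ‖Γ s x‖ ≤ C := by
  have hsub : Icc 0 T ×ˢ Icc m M ⊆ nodes T :=
    prod_mono le_rfl fun x hx => lt_of_lt_of_le hm hx.1
  obtain ⟨C, hC⟩ := (isCompact_Icc.prod isCompact_Icc).exists_bound_of_continuousOn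
    (hΓ.continuousOn.mono hsub)
  exact ⟨Real.toNNReal C, fun s hs x hx => (hC (s, x) ⟨hs, hx⟩).trans (Real.le_coe_toNNReal C)⟩

/-- Local existence with control of the time of existence, from an arbitrary time of the
interval. -/
theorem exists_local_solution (hT : 0 < T)
    (hΓ : ContDiffOn ℝ 1 (fun p : ℝ × ℝ => Γ p.1 p.2) (nodes T)) {x r : ℝ} {C : ℝ≥0}
    (hr : 0 ≤ r) (hx : 0 < x - r) (hC : ∀ s ∈ Icc 0 T, ∀ z ∈ Icc (x - r) (x + r), ‖Γ s z‖ ≤ C)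
    {t₁ t₂ t₀ : ℝ} (h₁ : 0 ≤ t₁) (h₂ : t₂ ≤ T) (h₀ : t₀ ∈ Icc t₁ t₂) (hδ : C * (t₂ - t₁) ≤ r) :
    ∃ y : ℝ → ℝ, y t₀ = x ∧ ∀ s ∈ Icc t₁ t₂, 0 < y s ∧
      HasDerivWithinAt y (Γ s (y s)) (Icc t₁ t₂) s := by
  lift r to ℝ≥0 using hr
  obtain ⟨K, hK⟩ := lipschitzOnWith_of_contDiffOn hT hΓ (m := x - r) (M := x + r) hx
  have hsub : Icc t₁ t₂ ⊆ Icc 0 T := Icc_subset_Icc h₁ h₂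
  have hPL : IsPicardLindelof Γ (⟨t₀, h₀⟩ : Icc t₁ t₂) x r 0 C K := by
    refine ⟨fun s hs => ?_, fun z hz => ?_, fun s hs z hz => ?_, ?_⟩
    · rw [Real.closedBall_eq_Icc]
      exact hK s (hsub hs)
    · rw [Real.closedBall_eq_Icc] at hz
      have hz0 : 0 < z := lt_of_lt_of_le hx hz.1
      exact hΓ.continuousOn.comp (f := fun s : ℝ => (s, z)) (by fun_prop)
        fun s hs => ⟨hsub hs, hz0⟩
    · rw [Real.closedBall_eq_Icc] at hz
      exact hC s (hsub hs) z hz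
    · simp only [NNReal.coe_zero, sub_zero]
      refine le_trans (mul_le_mul_of_nonneg_left ?_ C.coe_nonneg) hδ
      exact max_le (by linarith [h₀.1]) (by linarith [h₀.2])
  obtain ⟨α, hα⟩ := ODE.FunSpace.exists_isFixedPt_next hPL (x := x) (mem_closedBall_self le_rfl)
  refine ⟨α.compProj, ?_, fun s hs => ⟨?_, ?_⟩⟩
  · have := ODE.FunSpace.compProj_val (α := α) (t := ⟨t₀, h₀⟩)
    rw [this, ← hα, ODE.FunSpace.next_apply₀]
  · have := α.compProj_mem_closedBall hPL.mul_max_le (t := s)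
    rw [Real.closedBall_eq_Icc] at this
    exact lt_of_lt_of_le hx this.1
  · apply ODE.hasDerivWithinAt_picard_Icc h₀ hPL.continuousOn_uncurry
      α.continuous_compProj.continuousOn
      (fun _ ht' ↦ α.compProj_mem_closedBall hPL.mul_max_le)
      x hs |>.congr_of_mem _ hs
    intro t' ht'
    nth_rw 1 [← hα]
    rw [ODE.FunSpace.compProj_of_mem ht', ODE.FunSpace.next_apply]

/-- Concatenation of solutions. -/
theorem SolvesField.concat {t τ x : ℝ} (htτ : t ≤ τ) (hτ : τ ≤ T) {y₁ y₂ : ℝ → ℝ}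
    (h₁ : SolvesField Γ τ t x y₁) (h₂ : SolvesField Γ T τ (y₁ τ) y₂) :
    SolvesField Γ T t x (fun s => if s ≤ τ then y₁ s else y₂ s) := by
  refine ⟨by simp [htτ, h₁.1], fun s hs => ?_⟩
  have e1 : EqOn (fun s => if s ≤ τ then y₁ s else y₂ s) y₁ (Icc t τ) :=
    fun r hr => by simp [hr.2]
  have e2 : EqOn (fun s => if s ≤ τ then y₁ s else y₂ s) y₂ (Icc τ T) := by
    intro r hr
    rcases hr.1.eq_or_lt with h | h
    · simp [← h, h₂.1]
    · simp [not_le.2 h]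
  rw [← Icc_union_Icc_eq_Icc htτ hτ] at hs ⊢
  rcases lt_trichotomy s τ with h | h | h
  · have hs' : s ∈ Icc t τ := ⟨by rcases hs with hs | hs <;> linarith [hs.1], h.le⟩
    obtain ⟨hp, hd⟩ := h₁.2 s hs'
    rw [← e1 hs'] at hp hd
    refine ⟨hp, (hd.congr_of_mem e1 hs').mono_of_mem_nhdsWithin ?_⟩
    rw [nhdsWithin_union]
    refine mem_sup.2 ⟨self_mem_nhdsWithin, ?_⟩
    -- The other half-interval is closed and misses `s`, so it contributes nothing to the one-sided
    -- derivative.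
    have : 𝓝[Icc τ T] s = ⊥ := by
      rw [← notMem_closure_iff_nhdsWithin_eq_bot, isClosed_Icc.closure_eq]
      exact fun h'' => absurd h (not_lt.2 h''.1)
    rw [this]; exact mem_bot
  · subst h
    obtain ⟨hp, hd⟩ := h₁.2 s ⟨htτ, le_rfl⟩
    have hd2 := (h₂.2 s ⟨le_rfl, hτ⟩).2
    rw [h₂.1] at hd2
    have hv := e1 (⟨htτ, le_rfl⟩ : s ∈ Icc t s)
    rw [hv]
    exact ⟨hp, (hd.congr_of_mem e1 ⟨htτ, le_rfl⟩).union (hd2.congr_of_mem e2 ⟨le_rfl, hτ⟩)⟩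
  · have hs' : s ∈ Icc τ T := ⟨h.le, by rcases hs with hs | hs <;> linarith [hs.2]⟩
    obtain ⟨hp, hd⟩ := h₂.2 s hs'
    rw [← e2 hs'] at hp hd
    refine ⟨hp, (hd.congr_of_mem e2 hs').mono_of_mem_nhdsWithin ?_⟩
    rw [nhdsWithin_union]
    refine mem_sup.2 ⟨?_, self_mem_nhdsWithin⟩
    have : 𝓝[Icc t τ] s = ⊥ := by
      rw [← notMem_closure_iff_nhdsWithin_eq_bot, isClosed_Icc.closure_eq]
      exact fun h'' => absurd h (not_lt.2 h''.2)
    rw [this]; exact mem_bot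

theorem SolvesField.restrict {t τ T' x : ℝ} {y : ℝ → ℝ} (h : SolvesField Γ T t x y)
    (htτ : t ≤ τ) (hT' : T' ≤ T) : SolvesField Γ T' τ (y τ) y :=
  ⟨rfl, fun s hs => ⟨(h.2 s ⟨htτ.trans hs.1, hs.2.trans hT'⟩).1,
    (h.2 s ⟨htτ.trans hs.1, hs.2.trans hT'⟩).2.mono (Icc_subset_Icc htτ hT')⟩⟩

theorem SolvesField.congr_field {Γ' : ℝ → ℝ → ℝ} {t x : ℝ} {y : ℝ → ℝ}
    (h : SolvesField Γ T t x y) (hΓ : ∀ s ∈ Icc t T, Γ' s (y s) = Γ s (y s)) :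
    SolvesField Γ' T t x y :=
  ⟨h.1, fun s hs => ⟨(h.2 s hs).1, (hΓ s hs).symm ▸ (h.2 s hs).2⟩⟩

/-- A perturbation of a well-posed field that leaves it unchanged for stocks outside a compact
interval is well posed. -/
theorem WellPosed.of_eq_off {Γ' : ℝ → ℝ → ℝ} (hT : 0 < T)
    (hΓ' : ContDiffOn ℝ 1 (fun p : ℝ × ℝ => Γ' p.1 p.2) (nodes T))
    (h : WellPosed Γ T) {c d : ℝ} (hc : 0 < c) (hcd : c ≤ d)
    (heq : ∀ s ∈ Icc 0 T, ∀ x, 0 < x → x ∉ Icc c d → Γ' s x = Γ s x) : WellPosed Γ' T := by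
  -- Uniqueness is automatic for a `C¹` field; only existence up to time `T` is at stake.
  suffices hex : ∀ t ∈ Icc 0 T, ∀ x ∈ Ioi (0 : ℝ), ∃ y, SolvesField Γ' T t x y by
    intro t ht x hx
    obtain ⟨y, hy⟩ := hex t ht x hx
    exact ⟨y, hy, fun y' hy' => hy'.eqOn hT hΓ' ht.1 hy⟩
  -- The core is `[c/2, 2d]`, a neighbourhood of `[c, d]`. A ball of radius `c/4` about a core point
  -- lies in `[c/4, 3d]`, so one bound `C` yields one existence time `δ` for all core points.
  obtain ⟨C, hC⟩ := exists_bound_field hΓ' (m := c / 4) (M := 3 * d) (by positivity)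
  have hd : 0 < d := hc.trans_le hcd
  obtain ⟨δ, hδ, hCδ⟩ : ∃ δ > 0, C * δ ≤ c / 4 := by
    refine ⟨c / 4 / (C + 1), by positivity, ?_⟩
    rw [mul_div_assoc', div_le_iff₀ (by positivity)]
    nlinarith [C.coe_nonneg]
  -- from the core, then from everywhere
  have outer : ∀ t ∈ Icc 0 T,
      (∀ τ ∈ Icc t T, ∀ x ∈ Icc (c / 2) (2 * d), ∃ y, SolvesField Γ' T τ x y) →
      ∀ x ∈ Ioi (0 : ℝ), ∃ y, SolvesField Γ' T t x y := by
    intro t ht hcore x hx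
    obtain ⟨y, hy, -⟩ := h t ht x hx
    by_cases hhit : ∃ s ∈ Icc t T, y s ∈ Icc (c / 2) (2 * d)
    · have hcl : IsClosed (Icc t T ∩ y ⁻¹' Icc (c / 2) (2 * d)) :=
        hy.continuousOn.preimage_isClosed_of_isClosed isClosed_Icc isClosed_Icc
      have hne : (Icc t T ∩ y ⁻¹' Icc (c / 2) (2 * d)).Nonempty := hhit
      have hbdd : BddBelow (Icc t T ∩ y ⁻¹' Icc (c / 2) (2 * d)) := ⟨t, fun s hs => hs.1.1⟩
      -- Follow the old solution up to its first hitting time `τ` of the core. Until then it avoids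
      -- `[c, d]`, so it also solves the new equation; from `τ` on, a solution started in the core
      -- is glued on.
      set τ := sInf (Icc t T ∩ y ⁻¹' Icc (c / 2) (2 * d)) with hτdef
      have hτ := hcl.csInf_mem hne hbdd
      rw [← hτdef] at hτ
      have hbefore : ∀ s ∈ Ico t τ, y s ∉ Icc (c / 2) (2 * d) := fun s hs hys =>
        absurd (csInf_le hbdd ⟨⟨hs.1, hs.2.le.trans hτ.1.2⟩, hys⟩) (not_le.2 hs.2)
      rcases hτ.1.1.eq_or_lt with h0 | hlt
      · refine hcore t ⟨le_rfl, ht.2⟩ x ?_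
        have := hτ.2
        rw [mem_preimage, ← h0, hy.1] at this
        exact this
      · have hnot : ∀ s ∈ Icc t τ, y s ∉ Icc c d := by
          intro s hs hys
          rcases hs.2.eq_or_lt with h1 | h1
          · -- the first hitting time cannot lie strictly inside the core
            have hopen : ∀ᶠ r in 𝓝[Icc t τ] τ, y r ∈ Ioo (c / 2) (2 * d) := by
              have hcw : ContinuousWithinAt y (Icc t τ) τ :=
                (hy.continuousOn τ hτ.1).mono (Icc_subset_Icc_right hτ.1.2)
              refine hcw (isOpen_Ioo.mem_nhds ?_)
              rw [h1] at hys
              exact ⟨by linarith [hys.1], by linarith [hys.2]⟩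
            have hfr : ∃ᶠ r in 𝓝[Icc t τ] τ, r ∈ Ico t τ := by
              have hle : 𝓝[Ico t τ] τ ≤ 𝓝[Icc t τ] τ := nhdsWithin_mono _ Ico_subset_Icc_self
              have hnb : (𝓝[Ico t τ] τ).NeBot := by
                rw [← mem_closure_iff_nhdsWithin_neBot, closure_Ico hlt.ne]
                exact ⟨hlt.le, le_rfl⟩
              exact (eventually_mem_nhdsWithin (s := Ico t τ) (a := τ)).frequently.filter_mono hle
            obtain ⟨r, hr, hr'⟩ := (hfr.and_eventually hopen).exists
            exact hbefore r hr (Ioo_subset_Icc_self hr')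
          · exact hbefore s ⟨hs.1, h1⟩ ⟨by linarith [hys.1], by linarith [hys.2]⟩
        obtain ⟨y₂, hy₂⟩ := hcore τ hτ.1 (y τ) hτ.2
        refine ⟨_, SolvesField.concat hlt.le hτ.1.2 (y₁ := y) ?_ hy₂⟩
        have hr := hy.restrict (τ := t) le_rfl hτ.1.2
        rw [hy.1] at hr
        refine hr.congr_field fun s hs => ?_
        exact heq s ⟨ht.1.trans hs.1, hs.2.trans hτ.1.2⟩ _
          (hy.2 s ⟨hs.1, hs.2.trans hτ.1.2⟩).1 (hnot s hs)
    · push Not at hhit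
      refine ⟨y, hy.congr_field fun s hs => ?_⟩
      refine heq s ⟨ht.1.trans hs.1, hs.2⟩ _ (hy.2 s hs).1 fun hys => hhit s hs ?_
      exact ⟨by linarith [hys.1], by linarith [hys.2]⟩
  -- Induction on the number of steps of length `δ` that remain. After one local step the path may
  -- have left the core, but `outer` leads it on, and any return to the core happens with at most `n
  -- * δ` time left.
  have core : ∀ n : ℕ, ∀ t ∈ Icc 0 T, T - t ≤ n * δ → ∀ x ∈ Icc (c / 2) (2 * d),
      ∃ y, SolvesField Γ' T t x y := by
    intro n
    induction n with
    | zero =>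
      intro t ht htn x hx
      have : t = T := le_antisymm ht.2 (by simpa using htn)
      subst this
      -- At `t = T` the time interval is a single point, where every number is a derivative within
      -- the set.
      refine ⟨fun _ => x, rfl, fun s hs => ⟨by linarith [hx.1], ?_⟩⟩
      rw [Icc_self]
      rw [Icc_self] at hs
      rw [hs]
      exact hasDerivWithinAt_iff_hasFDerivWithinAt.2
        (HasFDerivWithinAt.of_subsingleton subsingleton_singleton)
    | succ n ih =>
      intro t ht htn x hx
      have hmin : t ≤ min (t + δ) T := le_min (by linarith) ht.2
      obtain ⟨y₁, h1, h1'⟩ := exists_local_solution (C := C) hT hΓ' (x := x) (r := c / 4)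
        (by positivity) (by linarith [hx.1])
        (fun s hs z hz => hC s hs z ⟨by linarith [hx.1, hz.1], by linarith [hx.2, hz.2]⟩)
        (t₁ := t) (t₂ := min (t + δ) T) (t₀ := t) ht.1 (min_le_right _ _) ⟨le_rfl, hmin⟩
        (le_trans (mul_le_mul_of_nonneg_left (by linarith [min_le_left (t + δ) T])
          C.coe_nonneg) hCδ)
      have hτ : min (t + δ) T ∈ Icc 0 T := ⟨ht.1.trans hmin, min_le_right _ _⟩
      obtain ⟨y₂, h2⟩ := outer (min (t + δ) T) hτ (fun τ' hτ' x' hx' => by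
        refine ih τ' ⟨hτ.1.trans hτ'.1, hτ'.2⟩ ?_ x' hx'
        push_cast at htn
        rcases min_choice (t + δ) T with hh | hh
        · rw [hh] at hτ'
          linarith [hτ'.1]
        · rw [hh] at hτ'
          have : 0 ≤ (n : ℝ) * δ := by positivity
          linarith [hτ'.1]) (y₁ (min (t + δ) T)) (h1' _ ⟨hmin, le_rfl⟩).1
      exact ⟨_, SolvesField.concat hmin hτ.2 ⟨h1, h1'⟩ h2⟩
  intro t ht x hx
  refine outer t ht (fun τ hτ x' hx' => ?_) x hx
  obtain ⟨n, hn⟩ := exists_nat_ge ((T - τ) / δ)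
  refine core n τ ⟨ht.1.trans hτ.1, hτ.2⟩ ?_ x' hx'
  rwa [div_le_iff₀ hδ] at hn

end Field

/-! ### Admissible deviations generated by feedback rules. -/

theorem contDiffOn_along {Φ : ℝ → ℝ → ℝ} {T t₀ : ℝ} {y : ℝ → ℝ}
    (hΦ : ContDiffOn ℝ 1 (fun p : ℝ × ℝ => Φ p.1 p.2) (nodes T)) (ht₀ : 0 ≤ t₀)
    (hy : ContDiffOn ℝ 1 y (Icc t₀ T)) (hpos : ∀ s ∈ Icc t₀ T, 0 < y s) :
    ContDiffOn ℝ 1 (fun s => Φ s (y s)) (Icc t₀ T) :=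
  hΦ.comp (f := fun s => (s, y s)) (contDiffOn_id.prodMk hy)
    fun s hs => ⟨⟨ht₀.trans hs.1, hs.2⟩, hpos s hs⟩

theorem continuousOn_along {Φ : ℝ → ℝ → ℝ} {T t₀ : ℝ} {y : ℝ → ℝ}
    (hΦ : ContinuousOn (fun p : ℝ × ℝ => Φ p.1 p.2) (nodes T)) (ht₀ : 0 ≤ t₀)
    (hy : ContinuousOn y (Icc t₀ T)) (hpos : ∀ s ∈ Icc t₀ T, 0 < y s) :
    ContinuousOn (fun s => Φ s (y s)) (Icc t₀ T) :=
  hΦ.comp (f := fun s => (s, y s)) (continuousOn_id.prodMk hy)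
    fun s hs => ⟨⟨ht₀.trans hs.1, hs.2⟩, hpos s hs⟩

/-- A function with a continuous derivative on a compact interval is of class `C¹` there. -/
theorem contDiffOn_one_of_hasDerivWithinAt {a b : ℝ} (hab : a < b) {y y' : ℝ → ℝ}
    (hd : ∀ s ∈ Icc a b, HasDerivWithinAt y (y' s) (Icc a b) s)
    (hc : ContinuousOn y' (Icc a b)) : ContDiffOn ℝ 1 y (Icc a b) := by
  rw [contDiffOn_one_iff_derivWithin (uniqueDiffOn_Icc hab)]
  refine ⟨fun s hs => (hd s hs).differentiableWithinAt, hc.congr fun s hs => ?_⟩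
  exact (hd s hs).derivWithin (uniqueDiffOn_Icc hab s hs)

theorem contDiffOn_field {g : Controls → ℝ} {T : ℝ} {U : Fin 2 → Set ℝ} {φ : FeedbackProfile}
    (hg : ∀ u : Controls, (∀ i, u i ∈ interior (U i)) → ContDiffAt ℝ 1 g u)
    (hφ : ∀ i, ContDiffOn ℝ 1 (fun p : ℝ × ℝ => φ i p.1 p.2) (nodes T))
    (hint : ∀ i, ∀ t ∈ Icc 0 T, ∀ x ∈ Ioi (0 : ℝ), φ i t x ∈ interior (U i)) :
    ContDiffOn ℝ 1 (fun p : ℝ × ℝ => g (φ.at p.1 p.2)) (nodes T) := by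
  intro p hp
  exact (hg (φ.at p.1 p.2) fun i => hint i p.1 hp.1 p.2 hp.2).comp_contDiffWithinAt p
    (f := fun p : ℝ × ℝ => φ.at p.1 p.2) (contDiffWithinAt_pi.2 fun i => hφ i p hp)

/-- Changing an admissible profile for stocks in a compact interval only gives an admissible
profile. -/
theorem IsAdmissible.of_eq_off {g : Controls → ℝ} {T : ℝ} (hT : 0 < T) {U : Fin 2 → Set ℝ}
    {φ ψ : FeedbackProfile}
    (hg : ∀ u : Controls, (∀ i, u i ∈ interior (U i)) → ContDiffAt ℝ 1 g u)
    (hφ : IsAdmissible g T U φ)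
    (hψ : ∀ i, ContDiffOn ℝ 1 (fun p : ℝ × ℝ => ψ i p.1 p.2) (nodes T))
    (hint : ∀ i, ∀ t ∈ Icc 0 T, ∀ x ∈ Ioi (0 : ℝ), ψ i t x ∈ interior (U i))
    {c d : ℝ} (hc : 0 < c) (hcd : c ≤ d)
    (heq : ∀ i s x, x ∉ Icc c d → ψ i s x = φ i s x) : IsAdmissible g T U ψ := by
  refine ⟨hψ, fun i t ht x hx => interior_subset (hint i t ht x hx), ?_⟩
  have hw : WellPosed (fun s x => g (φ.at s x)) T := hφ.2.2
  refine hw.of_eq_off (Γ' := fun s x => g (ψ.at s x)) hT (contDiffOn_field hg hψ hint) hc hcd ?_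
  intro s _ x _ hx
  show g _ = g _
  congr 1
  funext i
  exact heq i s x hx

/-- Any small modification of the control path along a given state path is generated by a feedback
profile that differs from the original one for stocks in a compact interval only. -/
theorem exists_deviation {T : ℝ} {U : Fin 2 → Set ℝ} {φ : FeedbackProfile}
    (hφ : ∀ i, ContDiffOn ℝ 1 (fun p : ℝ × ℝ => φ i p.1 p.2) (nodes T))
    (hint : ∀ i, ∀ t ∈ Icc 0 T, ∀ x ∈ Ioi (0 : ℝ), φ i t x ∈ interior (U i))
    {t₀ t₁ : ℝ} (ht₀ : 0 ≤ t₀) (ht₁ : t₀ < t₁) {y : ℝ → ℝ}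
    (hy : ContinuousOn y (Icc t₀ T)) (hpos : ∀ s ∈ Icc t₀ T, 0 < y s) :
    ∃ δ > 0, ∀ (z : ℝ → ℝ) (c : Fin 2 → ℝ → ℝ), ContDiffOn ℝ 1 z (Icc t₀ T) →
      (∀ k, ContDiffOn ℝ 1 (c k) (Icc t₀ T)) →
      (∀ s ∈ Icc t₀ T, |z s - y s| ≤ δ) →
      (∀ k, ∀ s ∈ Icc t₀ T, |c k s - φ k s (z s)| ≤ δ) →
      (∀ k, ∀ s ∈ Icc t₀ T, s ≤ t₁ → c k s = φ k s (z s)) →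
      ∃ ψ : FeedbackProfile,
        (∀ i, ContDiffOn ℝ 1 (fun p : ℝ × ℝ => ψ i p.1 p.2) (nodes T)) ∧
        (∀ i, ∀ t ∈ Icc 0 T, ∀ x ∈ Ioi (0 : ℝ), ψ i t x ∈ interior (U i)) ∧
        (∃ a b, 0 < a ∧ a ≤ b ∧ ∀ i s x, x ∉ Icc a b → ψ i s x = φ i s x) ∧
        (∀ s ∈ Icc t₀ T, 0 < z s) ∧
        (∀ k, ∀ s ∈ Icc t₀ T, ψ k s (z s) = c k s) ∧
        (∀ k, (∀ s ∈ Icc t₀ T, c k s = φ k s (z s)) → ψ k = φ k) := by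
  obtain ⟨m, M, hm, hmM, hb⟩ := exists_pos_bounds hy hpos
  have hM : 0 < M := hm.trans_le hmM
  -- The bump equals 1 on `[m/2, M + m/2]`, which contains every path within `m/2` of `y`, and
  -- vanishes off `[m/4, M + m]`, a compact part of `(0, ∞)`.
  let χ : ContDiffBump ((m + M) / 2 : ℝ) := ⟨M / 2, M / 2 + m / 4, by positivity, by linarith⟩
  have hχ1 : ∀ x ∈ Icc (m / 2) (M + m / 2), χ x = 1 := fun x hx => by
    refine χ.one_of_mem_closedBall ?_
    rw [Real.closedBall_eq_Icc]
    constructor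
    · show _ - M / 2 ≤ _
      linarith [hx.1]
    · show _ ≤ _ + M / 2
      linarith [hx.2]
  have hχ0 : ∀ x, x ∉ Icc (m / 4) (M + m) → χ x = 0 := fun x hx => by
    refine χ.zero_of_le_dist ?_
    by_contra hlt
    rw [not_le, ← mem_ball, Real.ball_eq_Ioo] at hlt
    apply hx
    have h1 : (m + M) / 2 - (M / 2 + m / 4) < x := hlt.1
    have h2 : x < (m + M) / 2 + (M / 2 + m / 4) := hlt.2
    constructor <;> linarith
  have hthick : ∀ k, ∃ δ > 0, ∀ s ∈ Icc 0 T, ∀ x ∈ Icc (m / 4) (M + m), ∀ e, |e| ≤ δ →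
      φ k s x + e ∈ interior (U k) := by
    intro k
    have hsub : Icc 0 T ×ˢ Icc (m / 4) (M + m) ⊆ nodes T :=
      prod_mono le_rfl fun x hx => lt_of_lt_of_le (by positivity) hx.1
    have hK := (isCompact_Icc.prod isCompact_Icc).image_of_continuousOn
      ((hφ k).continuousOn.mono hsub)
    obtain ⟨δ, hδ, hδs⟩ := hK.exists_cthickening_subset_open isOpen_interior (by
      rintro _ ⟨p, hp, rfl⟩
      exact hint k p.1 (hsub hp).1 p.2 (hsub hp).2)
    refine ⟨δ, hδ, fun s hs x hx e he => hδs ?_⟩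
    refine mem_cthickening_of_dist_le _ (φ k s x) _ _ ⟨(s, x), ⟨hs, hx⟩, rfl⟩ ?_
    simpa [Real.dist_eq] using he
  choose δk hδk hin using hthick
  refine ⟨min (m / 2) (min (δk 0) (δk 1)), lt_min (by positivity) (lt_min (hδk 0) (hδk 1)), ?_⟩
  intro z c hz hc hzy hcφ hc1
  have hzb : ∀ s ∈ Icc t₀ T, z s ∈ Icc (m / 2) (M + m / 2) := fun s hs => by
    have h1 := abs_le.1 ((hzy s hs).trans (min_le_left _ _))
    have h2 := hb s hs
    constructor <;> linarith [h1.1, h1.2, h2.1, h2.2]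
  have hzpos : ∀ s ∈ Icc t₀ T, 0 < z s := fun s hs => lt_of_lt_of_le (by positivity) (hzb s hs).1
  have hδle : ∀ k, min (m / 2) (min (δk 0) (δk 1)) ≤ δk k := by
    intro k
    fin_cases k
    · exact (min_le_right _ _).trans (min_le_left _ _)
    · exact (min_le_right _ _).trans (min_le_right _ _)
  classical
  -- The correction of rule `k`, as a function of time only; the new rule is `φ k + χ * D k`. As it
  -- vanishes up to `t₁ > t₀`, its extension by zero before `t₀` is still `C¹`.
  let D : Fin 2 → ℝ → ℝ := fun k s => if s ∈ Icc t₀ T then c k s - φ k s (z s) else 0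
  have hDin : ∀ k, ∀ s ∈ Icc t₀ T, D k s = c k s - φ k s (z s) := fun k s hs => if_pos hs
  have hDout : ∀ k s, s ∉ Icc t₀ T → D k s = 0 := fun k s hs => if_neg hs
  have hDabs : ∀ k s, |D k s| ≤ δk k := by
    intro k s
    by_cases hs : s ∈ Icc t₀ T
    · rw [hDin k s hs]
      exact (hcφ k s hs).trans (hδle k)
    · simp [hDout k s hs, (hδk k).le]
  have hD0 : ∀ k s, s ≤ t₁ → D k s = 0 := by
    intro k s hs1
    by_cases hs : s ∈ Icc t₀ T
    · rw [hDin k s hs, hc1 k s hs hs1, sub_self]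
    · exact hDout k s hs
  have hDC : ∀ k, ContDiffOn ℝ 1 (D k) (Icc 0 T) := by
    intro k s hs
    rcases lt_or_ge s t₁ with h | h
    · have : D k =ᶠ[𝓝 s] fun _ => 0 := by
        filter_upwards [Iio_mem_nhds h] with r hr using hD0 k r (le_of_lt hr)
      exact (contDiffAt_const.congr_of_eventuallyEq this).contDiffWithinAt
    · have hon : ContDiffOn ℝ 1 (D k) (Icc t₀ T) :=
        ((hc k).sub (contDiffOn_along (hφ k) ht₀ hz hzpos)).congr (hDin k)
      refine (hon s ⟨ht₁.le.trans h, hs.2⟩).mono_of_mem_nhdsWithin ?_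
      filter_upwards [mem_nhdsWithin_of_mem_nhds (Ioi_mem_nhds (ht₁.trans_le h)),
        self_mem_nhdsWithin] with r hr hr' using ⟨le_of_lt hr, hr'.2⟩
  refine ⟨fun k s x => φ k s x + χ x * D k s, fun k => ?_, fun k t ht x hx => ?_,
    ⟨m / 4, M + m, by positivity, by linarith, fun k s x hx => by simp [hχ0 x hx]⟩, hzpos,
    fun k s hs => ?_, fun k hk => ?_⟩
  · refine (hφ k).add (ContDiffOn.mul ?_ ?_)
    · exact (χ.contDiff.comp contDiff_snd).contDiffOn
    · exact (hDC k).comp contDiffOn_fst fun p hp => hp.1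
  · by_cases hxm : x ∈ Icc (m / 4) (M + m)
    · refine hin k t ht x hxm _ ?_
      rw [abs_mul, abs_of_nonneg χ.nonneg]
      exact (mul_le_of_le_one_left (abs_nonneg _) χ.le_one).trans (hDabs k t)
    · simpa [hχ0 x hxm] using hint k t ht x hx
  · simp only [hχ1 _ (hzb s hs), hDin k s hs]
    ring
  · funext s x
    have : D k s = 0 := by
      by_cases hs : s ∈ Icc t₀ T
      · rw [hDin k s hs, hk s hs, sub_self]
      · exact hDout k s hs
    simp [this]

/-! ### Tools from the calculus of variations. -/

theorem hasDerivAt_integral_of_continuousOn {P P' : ℝ → ℝ → ℝ} {a b e : ℝ} (hab : a ≤ b)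
    (he : 0 < e) (hP : ∀ ε ∈ Icc (-e) e, ContinuousOn (P ε) (Icc a b))
    (hP' : ContinuousOn (fun q : ℝ × ℝ => P' q.1 q.2) (Icc (-e) e ×ˢ Icc a b))
    (hd : ∀ s ∈ Icc a b, ∀ ε ∈ Icc (-e) e, HasDerivAt (fun ε => P ε s) (P' ε s) ε) :
    HasDerivAt (fun ε => ∫ s in a..b, P ε s) (∫ s in a..b, P' 0 s) 0 := by
  obtain ⟨C, hC⟩ := (isCompact_Icc.prod isCompact_Icc).exists_bound_of_continuousOn hP'
  have h0 : Icc (-e) e ∈ 𝓝 (0 : ℝ) := Icc_mem_nhds (by linarith) he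
  have hsub : Set.uIoc a b ⊆ Icc a b := by
    rw [uIoc_of_le hab]; exact Ioc_subset_Icc_self
  have hmem : (0 : ℝ) ∈ Icc (-e) e := ⟨by linarith, he.le⟩
  have hP'0 : ContinuousOn (P' 0) (Icc a b) :=
    hP'.comp (f := fun s : ℝ => ((0 : ℝ), s)) (by fun_prop) fun s hs => ⟨hmem, hs⟩
  refine (intervalIntegral.hasDerivAt_integral_of_dominated_loc_of_deriv_le
    (bound := fun _ => C) h0 ?_ ?_ ?_ ?_ ?_ ?_).2
  · filter_upwards [h0] with ε hε
    exact ((hP ε hε).mono hsub).aestronglyMeasurable measurableSet_uIoc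
  · exact ((hP 0 hmem).mono (by rw [uIcc_of_le hab])).intervalIntegrable
  · exact (hP'0.mono hsub).aestronglyMeasurable measurableSet_uIoc
  · exact .of_forall fun s hs ε hε => hC (ε, s) ⟨hε, hsub hs⟩
  · exact intervalIntegrable_const
  · exact .of_forall fun s hs ε hε => hd s (hsub hs) ε hε

/-- Uniform continuity on a compact rectangle turns pointwise vanishing at `ε = 0` into smallness
uniform in time. This keeps the perturbed paths and controls within the tolerance of
`exists_deviation`. -/
theorem eventually_abs_le_of_continuousOn {D : ℝ → ℝ → ℝ} {a b e : ℝ} (he : 0 < e)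
    (hD : ContinuousOn (fun q : ℝ × ℝ => D q.1 q.2) (Icc (-e) e ×ˢ Icc a b))
    (h0 : ∀ s ∈ Icc a b, D 0 s = 0) {δ : ℝ} (hδ : 0 < δ) :
    ∀ᶠ ε in 𝓝 (0 : ℝ), ∀ s ∈ Icc a b, |D ε s| ≤ δ := by
  have hu := (isCompact_Icc.prod isCompact_Icc).uniformContinuousOn_of_continuous hD
  obtain ⟨κ, hκ, hκ'⟩ := Metric.uniformContinuousOn_iff.1 hu δ hδ
  have h1 : Icc (-e) e ∈ 𝓝 (0 : ℝ) := Icc_mem_nhds (by linarith) he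
  filter_upwards [h1, ball_mem_nhds (0 : ℝ) hκ] with ε hε hεκ s hs
  have := hκ' (ε, s) ⟨hε, hs⟩ (0, s) ⟨⟨by linarith, he.le⟩, hs⟩ (by
    simpa [Prod.dist_eq, hκ] using hεκ)
  simp only [h0 s hs, Real.dist_eq, sub_zero] at this
  exact this.le

/-- The fundamental lemma of the calculus of variations on an interval. -/
theorem eq_zero_of_forall_integral_mul_eq_zero {r : ℝ → ℝ} {a b : ℝ} (hab : a < b)
    (hr : ContinuousOn r (Icc a b))
    (h : ∀ η : ℝ → ℝ, ContDiff ℝ ∞ η → ∀ t₁ ∈ Ioo a b, (∀ s ≤ t₁, η s = 0) → η b = 0 →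
      ∫ s in a..b, r s * η s = 0) : ∀ s ∈ Icc a b, r s = 0 := by
  have hae : ∀ᵐ s, s ∈ Ioo a b → r s = 0 := by
    refine isOpen_Ioo.ae_eq_zero_of_integral_contDiff_smul_eq_zero
      ((hr.mono Ioo_subset_Icc_self).locallyIntegrableOn measurableSet_Ioo) ?_
    intro η hη hcs hsupp
    have hzero : ∀ s, s ∉ Ioo a b → η s = 0 := fun s hs =>
      image_eq_zero_of_notMem_tsupport fun h' => hs (hsupp h')
    -- Halfway between `a` and the least point of the support: the test functions must vanish on an
    -- initial interval for the deviation to be `C¹`.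
    obtain ⟨t₁, ht₁, ht₁'⟩ : ∃ t₁ ∈ Ioo a b, ∀ s ≤ t₁, η s = 0 := by
      rcases (tsupport η).eq_empty_or_nonempty with h0 | hne
      · refine ⟨(a + b) / 2, ⟨by linarith, by linarith⟩, fun s _ => ?_⟩
        exact image_eq_zero_of_notMem_tsupport (by simp [h0])
      · obtain ⟨p, hp, hpm⟩ := hcs.isCompact.exists_isLeast hne
        have hp' := hsupp hp
        refine ⟨(a + p) / 2, ⟨by linarith [hp'.1], by linarith [hp'.1, hp'.2]⟩, fun s hs => ?_⟩
        refine image_eq_zero_of_notMem_tsupport fun h' => ?_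
        linarith [hpm h', hp'.1]
    have := h η hη t₁ ht₁ ht₁' (hzero b (by simp))
    rw [intervalIntegral.integral_of_le hab.le] at this
    rw [← this, ← MeasureTheory.integral_indicator measurableSet_Ioc]
    congr 1
    funext s
    by_cases hs : s ∈ Ioc a b
    · simp [indicator_of_mem hs, mul_comm]
    · rw [indicator_of_notMem hs, hzero s fun h' => hs ⟨h'.1, h'.2.le⟩, zero_smul]
  have hIoo : EqOn r 0 (Ioo a b) := by
    refine MeasureTheory.Measure.eqOn_open_of_ae_eq (μ := MeasureTheory.volume) ?_ isOpen_Ioo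
      (hr.mono Ioo_subset_Icc_self) continuousOn_const
    rw [Filter.EventuallyEq, MeasureTheory.ae_restrict_iff' measurableSet_Ioo]
    exact hae
  have hcl : EqOn r 0 (Icc a b) := hIoo.of_subset_closure hr continuousOn_const
    Ioo_subset_Icc_self (by rw [closure_Ioo hab.ne])
  exact hcl

/-! ### Smoothness of the data of the game, and derivatives of functions of the node. -/

theorem contDiffAt_own (G : AdditiveDuopoly) (i : Fin 2) {w : ℝ} (hw : w ∈ interior (G.U i)) :
    ContDiffAt ℝ 2 (G.own i) w :=
  (G.own_smooth i).contDiffAt (mem_interior_iff_mem_nhds.1 hw)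

theorem contDiffAt_ext (G : AdditiveDuopoly) (i : Fin 2) {w : ℝ}
    (hw : w ∈ interior (G.U (1 - i))) : ContDiffAt ℝ 2 (G.ext i) w :=
  (G.ext_smooth i).contDiffAt (mem_interior_iff_mem_nhds.1 hw)

theorem contDiffAt_deriv {f : ℝ → ℝ} {w : ℝ} (hf : ContDiffAt ℝ 2 f w) :
    ContDiffAt ℝ 1 (deriv f) w := by
  have h : ContDiffAt ℝ (1 + 1) f w := hf
  exact h.derivWithin le_rfl

theorem AdditiveDuopoly.dynamics_eq (G : AdditiveDuopoly) (i : Fin 2) (u : Controls) :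
    G.dynamics u = -(u i + u (1 - i)) := by
  fin_cases i
  · simp [AdditiveDuopoly.dynamics, Fin.sum_univ_two]
  · simp [AdditiveDuopoly.dynamics, Fin.sum_univ_two, add_comm]

theorem AdditiveDuopoly.contDiff_dynamics (G : AdditiveDuopoly) : ContDiff ℝ 1 G.dynamics := by
  have : G.dynamics = fun u : Controls => -(u 0 + u 1) := by
    funext u
    exact G.dynamics_eq 0 u
  rw [this]
  fun_prop

theorem one_sub_ne (i : Fin 2) : 1 - i ≠ i := by
  fin_cases i <;> simp

/-- The time derivative of a function of the node, one-sided at the ends of `[0, T]`. -/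
noncomputable def timeDeriv (T : ℝ) (Φ : ℝ → ℝ → ℝ) (t x : ℝ) : ℝ :=
  fderivWithin ℝ (fun p : ℝ × ℝ => Φ p.1 p.2) (nodes T) (t, x) (1, 0)

/-- The derivative of a function of the node with respect to the stock. -/
noncomputable def stockDeriv (T : ℝ) (Φ : ℝ → ℝ → ℝ) (t x : ℝ) : ℝ :=
  fderivWithin ℝ (fun p : ℝ × ℝ => Φ p.1 p.2) (nodes T) (t, x) (0, 1)

section Nodes

variable {T : ℝ} {Φ : ℝ → ℝ → ℝ}

theorem continuousOn_timeDeriv (hT : 0 < T)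
    (hΦ : ContDiffOn ℝ 1 (fun p : ℝ × ℝ => Φ p.1 p.2) (nodes T)) :
    ContinuousOn (fun p : ℝ × ℝ => timeDeriv T Φ p.1 p.2) (nodes T) :=
  (hΦ.continuousOn_fderivWithin (uniqueDiffOn_nodes hT) le_rfl).clm_apply continuousOn_const

theorem continuousOn_stockDeriv (hT : 0 < T)
    (hΦ : ContDiffOn ℝ 1 (fun p : ℝ × ℝ => Φ p.1 p.2) (nodes T)) :
    ContinuousOn (fun p : ℝ × ℝ => stockDeriv T Φ p.1 p.2) (nodes T) :=
  (hΦ.continuousOn_fderivWithin (uniqueDiffOn_nodes hT) le_rfl).clm_apply continuousOn_const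

theorem hasFDerivWithinAt_nodes
    (hΦ : ContDiffOn ℝ 1 (fun p : ℝ × ℝ => Φ p.1 p.2) (nodes T)) {t x : ℝ} (ht : t ∈ Icc 0 T)
    (hx : 0 < x) : HasFDerivWithinAt (fun p : ℝ × ℝ => Φ p.1 p.2)
      (fderivWithin ℝ (fun p : ℝ × ℝ => Φ p.1 p.2) (nodes T) (t, x)) (nodes T) (t, x) :=
  (hΦ.differentiableOn one_ne_zero (t, x) ⟨ht, hx⟩).hasFDerivWithinAt

theorem hasDerivAt_stock
    (hΦ : ContDiffOn ℝ 1 (fun p : ℝ × ℝ => Φ p.1 p.2) (nodes T)) {t x : ℝ} (ht : t ∈ Icc 0 T)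
    (hx : 0 < x) : HasDerivAt (fun z => Φ t z) (stockDeriv T Φ t x) x := by
  have h := hasFDerivWithinAt_nodes hΦ ht hx
  have hl : HasDerivWithinAt (fun z : ℝ => (t, z)) ((0 : ℝ), (1 : ℝ)) (Ioi 0) x :=
    ((hasDerivAt_const x t).prodMk (hasDerivAt_id x)).hasDerivWithinAt
  have hmap : MapsTo (fun z : ℝ => (t, z)) (Ioi 0) (nodes T) := fun z hz => ⟨ht, hz⟩
  have := h.comp_hasDerivWithinAt x hl hmap
  exact this.hasDerivAt (Ioi_mem_nhds hx)

theorem hasDerivWithinAt_along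
    (hΦ : ContDiffOn ℝ 1 (fun p : ℝ × ℝ => Φ p.1 p.2) (nodes T)) {t₀ : ℝ} (ht₀ : 0 ≤ t₀)
    {y : ℝ → ℝ} {y' s : ℝ} (hs : s ∈ Icc t₀ T) (hpos : ∀ r ∈ Icc t₀ T, 0 < y r)
    (hy : HasDerivWithinAt y y' (Icc t₀ T) s) :
    HasDerivWithinAt (fun r => Φ r (y r))
      (timeDeriv T Φ s (y s) + stockDeriv T Φ s (y s) * y') (Icc t₀ T) s := by
  have h := hasFDerivWithinAt_nodes hΦ ⟨ht₀.trans hs.1, hs.2⟩ (hpos s hs)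
  have hl : HasDerivWithinAt (fun r : ℝ => (r, y r)) ((1 : ℝ), y') (Icc t₀ T) s :=
    (hasDerivWithinAt_id s _).prodMk hy
  have hmap : MapsTo (fun r : ℝ => (r, y r)) (Icc t₀ T) (nodes T) :=
    fun r hr => ⟨⟨ht₀.trans hr.1, hr.2⟩, hpos r hr⟩
  have e : ((1 : ℝ), y') = (1, 0) + y' • ((0 : ℝ), (1 : ℝ)) := by simp
  have e' : fderivWithin ℝ (fun p : ℝ × ℝ => Φ p.1 p.2) (nodes T) (s, y s) (1, y') =
      timeDeriv T Φ s (y s) + stockDeriv T Φ s (y s) * y' := by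
    rw [e, map_add, map_smul, smul_eq_mul, mul_comm]
    rfl
  rw [← e']
  exact h.comp_hasDerivWithinAt s hl hmap

end Nodes

/-! ### Necessary conditions for the players: first variation, Euler–Lagrange equation,
transversality. -/

theorem exists_pos_margin {a b : ℝ} {y η : ℝ → ℝ} (hy : ContinuousOn y (Icc a b))
    (hpos : ∀ s ∈ Icc a b, 0 < y s) (hη : ContinuousOn η (Icc a b)) :
    ∃ e > 0, ∀ ε ∈ Icc (-e) e, ∀ s ∈ Icc a b, 0 < y s + ε * η s := by
  obtain ⟨m, M, hm, -, hb⟩ := exists_pos_bounds hy hpos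
  obtain ⟨C, hC⟩ := isCompact_Icc.exists_bound_of_continuousOn hη
  refine ⟨m / (2 * (|C| + 1)), by positivity, fun ε hε s hs => ?_⟩
  have h1 : |ε * η s| ≤ m / (2 * (|C| + 1)) * (|C| + 1) := by
    rw [abs_mul]
    refine mul_le_mul (abs_le.2 hε) ?_ (abs_nonneg _) (by positivity)
    exact ((hC s hs).trans (le_abs_self C)).trans (by linarith)
  have h2 : m / (2 * (|C| + 1)) * (|C| + 1) = m / 2 := by
    field_simp
  rw [h2] at h1
  linarith [(abs_le.1 h1).1, (hb s hs).1]

theorem continuousOn_variation {T : ℝ} {Φ : ℝ → ℝ → ℝ}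
    (hΦ : ContinuousOn (fun p : ℝ × ℝ => Φ p.1 p.2) (nodes T)) {t₀ e : ℝ} (ht₀ : 0 ≤ t₀)
    {y η : ℝ → ℝ} (hy : ContinuousOn y (Icc t₀ T)) (hη : Continuous η)
    (hpos : ∀ ε ∈ Icc (-e) e, ∀ s ∈ Icc t₀ T, 0 < y s + ε * η s) :
    ContinuousOn (fun q : ℝ × ℝ => Φ q.2 (y q.2 + q.1 * η q.2)) (Icc (-e) e ×ˢ Icc t₀ T) := by
  refine hΦ.comp (f := fun q : ℝ × ℝ => (q.2, y q.2 + q.1 * η q.2)) ?_ ?_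
  · refine continuousOn_snd.prodMk (ContinuousOn.add ?_ (by fun_prop))
    exact hy.comp continuousOn_snd fun q hq => hq.2
  · exact fun q hq => ⟨⟨ht₀.trans hq.2.1, hq.2.2⟩, hpos q.1 hq.1 q.2 hq.2⟩

/-- The first variation of a player's payoff along an equilibrium trajectory vanishes. -/
theorem firstVariation_eq_zero (G : AdditiveDuopoly) (φ : FeedbackProfile) (hφ : G.IsMPNE φ)
    (hint : ∀ i, ∀ t ∈ Icc 0 G.T, ∀ x ∈ Ioi (0 : ℝ), φ i t x ∈ interior (G.U i)) (i : Fin 2)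
    {t₀ x₀ : ℝ} (ht₀ : t₀ ∈ Ico 0 G.T) (hx₀ : 0 < x₀) {y : ℝ → ℝ}
    (hy : IsTrajectory G.dynamics G.T φ t₀ x₀ y) {η : ℝ → ℝ} (hη : ContDiff ℝ ∞ η) {t₁ : ℝ}
    (ht₁ : t₀ < t₁) (hη₁ : ∀ s ≤ t₁, η s = 0) :
    (∫ s in t₀..G.T, (deriv (G.own i) (φ i s (y s)) *
        (-deriv η s - stockDeriv G.T (φ (1 - i)) s (y s) * η s) +
        deriv (G.ext i) (φ (1 - i) s (y s)) * (stockDeriv G.T (φ (1 - i)) s (y s) * η s))) +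
      deriv (G.bequest i) (y G.T) * η G.T = 0 := by
  have hT := G.T_pos
  have hφC := hφ.1.1
  have hle : t₀ ≤ G.T := ht₀.2.le
  have hpos : ∀ s ∈ Icc t₀ G.T, 0 < y s := fun s hs => (hy.2 s hs).1
  have hyc : ContinuousOn y (Icc t₀ G.T) := fun s hs => (hy.2 s hs).2.continuousWithinAt
  have hdyn : ∀ s, G.dynamics (φ.at s (y s)) = -(φ i s (y s) + φ (1 - i) s (y s)) :=
    fun s => G.dynamics_eq i _
  have hηc : Continuous η := hη.continuous
  have hη'c : ContDiff ℝ ∞ (deriv η) := (contDiff_infty_iff_deriv.1 hη).2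
  have hηd : ∀ s, HasDerivAt η (deriv η s) s := fun s =>
    (hη.differentiable (by simp) s).hasDerivAt
  have hy1 : ContDiffOn ℝ 1 y (Icc t₀ G.T) := by
    refine contDiffOn_one_of_hasDerivWithinAt ht₀.2 (fun s hs => (hy.2 s hs).2) ?_
    exact continuousOn_along (Φ := fun s x => G.dynamics (φ.at s x))
      (contDiffOn_field (fun u _ => G.contDiff_dynamics.contDiffAt) hφC hint).continuousOn
      ht₀.1 hyc hpos
  obtain ⟨e₀, he₀, hpos₀⟩ := exists_pos_margin hyc hpos hηc.continuousOn
  set j := 1 - i with hj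
  let Y : ℝ → ℝ → ℝ := fun ε s => y s + ε * η s
  let A : ℝ → ℝ := fun s => φ i s (y s) + φ j s (y s)
  -- The own control forced by the path `y + εη`: total extraction must be `A - ε η'`, and the rival
  -- extracts what his rule prescribes at the perturbed stock.
  let Cc : ℝ → ℝ → ℝ := fun ε s => A s - ε * deriv η s - φ j s (Y ε s)
  have hYj : ∀ {Φ : ℝ → ℝ → ℝ}, ContinuousOn (fun p : ℝ × ℝ => Φ p.1 p.2) (nodes G.T) →
      ContinuousOn (fun q : ℝ × ℝ => Φ q.2 (Y q.1 q.2)) (Icc (-e₀) e₀ ×ˢ Icc t₀ G.T) :=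
    fun hΦ => continuousOn_variation hΦ ht₀.1 hyc hηc hpos₀
  have hAc : ContinuousOn A (Icc t₀ G.T) :=
    (continuousOn_along (hφC i).continuousOn ht₀.1 hyc hpos).add
      (continuousOn_along (hφC j).continuousOn ht₀.1 hyc hpos)
  have hCj : ContinuousOn (fun q : ℝ × ℝ => Cc q.1 q.2) (Icc (-e₀) e₀ ×ˢ Icc t₀ G.T) := by
    refine ContinuousOn.sub (ContinuousOn.sub ?_ ?_) (hYj (hφC j).continuousOn)
    · exact hAc.comp continuousOn_snd fun q hq => hq.2
    · have := hη'c.continuous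
      fun_prop
  have hC0 : ∀ s, Cc 0 s = φ i s (y s) := fun s => by simp [Cc, A, Y]
  -- controls stay admissible
  have hthick : ∃ δ > 0, ∀ s ∈ Icc t₀ G.T, ∀ w, |w - φ i s (y s)| ≤ δ → w ∈ interior (G.U i) := by
    have hK := (isCompact_Icc (a := t₀) (b := G.T)).image_of_continuousOn
      (continuousOn_along (hφC i).continuousOn ht₀.1 hyc hpos)
    obtain ⟨δ, hδ, hδs⟩ := hK.exists_cthickening_subset_open isOpen_interior (by
      rintro _ ⟨s, hs, rfl⟩
      exact hint i s ⟨ht₀.1.trans hs.1, hs.2⟩ _ (hpos s hs))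
    refine ⟨δ, hδ, fun s hs w hw => hδs ?_⟩
    exact mem_cthickening_of_dist_le _ (φ i s (y s)) _ _ ⟨s, hs, rfl⟩ hw
  obtain ⟨δ₁, hδ₁, hthick⟩ := hthick
  have hin : ∀ᶠ ε in 𝓝 (0 : ℝ), ∀ s ∈ Icc t₀ G.T, Cc ε s ∈ interior (G.U i) := by
    have := eventually_abs_le_of_continuousOn (D := fun ε s => Cc ε s - φ i s (y s)) he₀
      (hCj.sub ((continuousOn_along (hφC i).continuousOn ht₀.1 hyc hpos).comp continuousOn_snd
        fun q hq => hq.2)) (fun s _ => by simp [hC0]) hδ₁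
    filter_upwards [this] with ε hε s hs using hthick s hs _ (hε s hs)
  obtain ⟨e, he, hee, hin⟩ : ∃ e > 0, e ≤ e₀ ∧
      ∀ ε ∈ Icc (-e) e, ∀ s ∈ Icc t₀ G.T, Cc ε s ∈ interior (G.U i) := by
    obtain ⟨κ, hκ, hκ'⟩ := Metric.eventually_nhds_iff.1 hin
    refine ⟨min (κ / 2) e₀, by positivity, min_le_right _ _, fun ε hε => hκ' ?_⟩
    rw [Real.dist_eq, sub_zero]
    have := (abs_le.2 hε).trans (min_le_left _ _)
    linarith
  have hbox : Icc (-e) e ×ˢ Icc t₀ G.T ⊆ Icc (-e₀) e₀ ×ˢ Icc t₀ G.T :=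
    prod_mono (Icc_subset_Icc (by linarith) hee) le_rfl
  have hYnode : ∀ ε ∈ Icc (-e) e, ∀ s ∈ Icc t₀ G.T, s ∈ Icc 0 G.T ∧ 0 < Y ε s :=
    fun ε hε s hs => ⟨⟨ht₀.1.trans hs.1, hs.2⟩, hpos₀ ε ⟨by linarith [hε.1], hε.2.trans hee⟩ s hs⟩
  have hjint : ∀ ε ∈ Icc (-e) e, ∀ s ∈ Icc t₀ G.T, φ j s (Y ε s) ∈ interior (G.U j) :=
    fun ε hε s hs => hint j s (hYnode ε hε s hs).1 _ (hYnode ε hε s hs).2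
  let P : ℝ → ℝ → ℝ := fun ε s => G.own i (Cc ε s) + G.ext i (φ j s (Y ε s))
  let P' : ℝ → ℝ → ℝ := fun ε s =>
    deriv (G.own i) (Cc ε s) * (-deriv η s - stockDeriv G.T (φ j) s (Y ε s) * η s) +
      deriv (G.ext i) (φ j s (Y ε s)) * (stockDeriv G.T (φ j) s (Y ε s) * η s)
  have hCb := hCj.mono hbox
  have hφb := (hYj (hφC j).continuousOn).mono hbox
  have hsb := (hYj (continuousOn_stockDeriv hT (hφC j))).mono hbox
  have hηb : ContinuousOn (fun q : ℝ × ℝ => η q.2) (Icc (-e) e ×ˢ Icc t₀ G.T) := by fun_prop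
  have hη'b : ContinuousOn (fun q : ℝ × ℝ => deriv η q.2) (Icc (-e) e ×ˢ Icc t₀ G.T) := by
    have := hη'c.continuous
    fun_prop
  have hcomp : ∀ {f : ℝ → ℝ} {S : Set ℝ} {κ : ℝ × ℝ → ℝ}, (∀ w ∈ S, ContinuousAt f w) →
      ContinuousOn κ (Icc (-e) e ×ˢ Icc t₀ G.T) → (∀ q ∈ Icc (-e) e ×ˢ Icc t₀ G.T, κ q ∈ S) →
      ContinuousOn (fun q => f (κ q)) (Icc (-e) e ×ˢ Icc t₀ G.T) :=
    fun hf hκ hS q hq => (hf _ (hS q hq)).comp_continuousWithinAt (hκ q hq)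
  have hPj : ContinuousOn (fun q : ℝ × ℝ => P q.1 q.2) (Icc (-e) e ×ˢ Icc t₀ G.T) := by
    refine ContinuousOn.add ?_ ?_
    · exact hcomp (fun w hw => (contDiffAt_own G i hw).continuousAt) hCb
        fun q hq => hin q.1 hq.1 q.2 hq.2
    · exact hcomp (fun w hw => (contDiffAt_ext G i hw).continuousAt) hφb
        fun q hq => hjint q.1 hq.1 q.2 hq.2
  have hP'j : ContinuousOn (fun q : ℝ × ℝ => P' q.1 q.2) (Icc (-e) e ×ˢ Icc t₀ G.T) := by
    refine ContinuousOn.add (ContinuousOn.mul ?_ ?_) (ContinuousOn.mul ?_ (hsb.mul hηb))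
    · exact hcomp (fun w hw => (contDiffAt_deriv (contDiffAt_own G i hw)).continuousAt) hCb
        fun q hq => hin q.1 hq.1 q.2 hq.2
    · exact hη'b.neg.sub (hsb.mul hηb)
    · exact hcomp (fun w hw => (contDiffAt_deriv (contDiffAt_ext G i hw)).continuousAt) hφb
        fun q hq => hjint q.1 hq.1 q.2 hq.2
  have hPd : ∀ s ∈ Icc t₀ G.T, ∀ ε ∈ Icc (-e) e,
      HasDerivAt (fun ε => P ε s) (P' ε s) ε := by
    intro s hs ε hε
    have hYd : HasDerivAt (fun ε => Y ε s) (η s) ε := by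
      have := ((hasDerivAt_id ε).mul_const (η s)).const_add (y s)
      rwa [one_mul] at this
    have hφd : HasDerivAt (fun ε => φ j s (Y ε s))
        (stockDeriv G.T (φ j) s (Y ε s) * η s) ε :=
      (hasDerivAt_stock (hφC j) (hYnode ε hε s hs).1 (hYnode ε hε s hs).2).comp ε hYd
    have hCd : HasDerivAt (fun ε => Cc ε s)
        (-deriv η s - stockDeriv G.T (φ j) s (Y ε s) * η s) ε := by
      have := (((hasDerivAt_id ε).mul_const (deriv η s)).const_sub (A s)).sub hφd
      rwa [one_mul] at this
    have ho := ((contDiffAt_own G i (hin ε hε s hs)).differentiableAt two_ne_zero).hasDerivAt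
    have hx := ((contDiffAt_ext G i (hjint ε hε s hs)).differentiableAt two_ne_zero).hasDerivAt
    exact (ho.comp ε hCd).add (hx.comp ε hφd)
  have hPs : ∀ ε ∈ Icc (-e) e, ContinuousOn (P ε) (Icc t₀ G.T) := fun ε hε =>
    hPj.comp (f := fun s : ℝ => (ε, s)) (by fun_prop) fun s hs => ⟨hε, hs⟩
  have hTm : G.T ∈ Icc t₀ G.T := ⟨hle, le_rfl⟩
  have hI := hasDerivAt_integral_of_continuousOn hle he hPs hP'j hPd
  have hB : HasDerivAt (fun ε => G.bequest i (Y ε G.T)) (deriv (G.bequest i) (y G.T) * η G.T) 0 := by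
    have hYd : HasDerivAt (fun ε => Y ε G.T) (η G.T) 0 := by
      have := ((hasDerivAt_id (0 : ℝ)).mul_const (η G.T)).const_add (y G.T)
      rwa [one_mul] at this
    have hb : HasDerivAt (G.bequest i) (deriv (G.bequest i) (y G.T)) (Y 0 G.T) := by
      have : Y 0 G.T = y G.T := by simp [Y]
      rw [this]
      exact (((G.bequest_smooth i).contDiffAt (Ioi_mem_nhds (hpos _ hTm))).differentiableAt
        two_ne_zero).hasDerivAt
    exact hb.comp 0 hYd
  have hJ := hI.add hB
  -- optimality
  have hmax : IsLocalMax (fun ε => (∫ s in t₀..G.T, P ε s) + G.bequest i (Y ε G.T)) 0 := by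
    obtain ⟨δ, hδ, hdev⟩ := exists_deviation hφC hint ht₀.1 ht₁ hyc hpos
    have hsm1 := eventually_abs_le_of_continuousOn (D := fun ε s => Cc ε s - φ i s (Y ε s)) he₀
      (hCj.sub (hYj (hφC i).continuousOn)) (fun s _ => by simp [hC0, Y]) hδ
    have hsm2 := eventually_abs_le_of_continuousOn (D := fun ε s => Y ε s - y s)
      (a := t₀) (b := G.T) he₀ (by simp only [Y, add_sub_cancel_left]; fun_prop)
      (fun s _ => by simp [Y]) hδ
    filter_upwards [hsm1, hsm2, Icc_mem_nhds (neg_lt_zero.2 he) he] with ε h1 h2 hε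
    have hYC : ContDiffOn ℝ 1 (Y ε) (Icc t₀ G.T) :=
      hy1.add (contDiffOn_const.mul (hη.of_le (by simp)).contDiffOn)
    have hYpos : ∀ s ∈ Icc t₀ G.T, 0 < Y ε s := fun s hs => (hYnode ε hε s hs).2
    have hderiv0 : ∀ s ≤ t₁, deriv η s = 0 := by
      intro s hs
      have hE : EqOn η 0 (Iic t₁) := fun r hr => hη₁ r hr
      have h1 := (hηd s).hasDerivWithinAt (s := Iic t₁)
      have h2 : HasDerivWithinAt η 0 (Iic t₁) s :=
        (hasDerivWithinAt_const s (Iic t₁) (0 : ℝ)).congr hE (hE hs)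
      exact (uniqueDiffOn_Iic t₁ s hs).eq_deriv _ h1 h2
    -- The rival's control path is his own rule evaluated on the new path, so the last clause of
    -- `exists_deviation` leaves that rule untouched and the deviation is unilateral.
    let c : Fin 2 → ℝ → ℝ := fun k => if k = i then Cc ε else fun s => φ k s (Y ε s)
    have hci : c i = Cc ε := if_pos rfl
    have hck : ∀ k, k ≠ i → c k = fun s => φ k s (Y ε s) := fun k hk => if_neg hk
    have hcC : ∀ k, ContDiffOn ℝ 1 (c k) (Icc t₀ G.T) := by
      intro k
      by_cases hk : k = i
      · rw [hk, hci]
        refine ContDiffOn.sub (ContDiffOn.sub ((contDiffOn_along (hφC i) ht₀.1 hy1 hpos).add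
          (contDiffOn_along (hφC j) ht₀.1 hy1 hpos)) ?_) (contDiffOn_along (hφC j) ht₀.1 hYC hYpos)
        exact contDiffOn_const.mul (hη'c.of_le (by simp)).contDiffOn
      · rw [hck k hk]
        exact contDiffOn_along (hφC k) ht₀.1 hYC hYpos
    have hcδ : ∀ k, ∀ s ∈ Icc t₀ G.T, |c k s - φ k s (Y ε s)| ≤ δ := by
      intro k s hs
      by_cases hk : k = i
      · rw [hk, hci]
        exact h1 s hs
      · rw [hck k hk]
        simp [hδ.le]
    have hc1 : ∀ k, ∀ s ∈ Icc t₀ G.T, s ≤ t₁ → c k s = φ k s (Y ε s) := by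
      intro k s hs hs1
      by_cases hk : k = i
      · rw [hk, hci]
        simp [Cc, A, Y, hη₁ s hs1, hderiv0 s hs1]
      · rw [hck k hk]
    obtain ⟨ψ, hψC, hψint, ⟨a, b, ha, hab, hoff⟩, -, hψc, hψk⟩ := hdev (Y ε) c hYC hcC h2 hcδ hc1
    have hψeq : Function.update φ i (ψ i) = ψ := by
      funext k
      by_cases hk : k = i
      · subst hk; simp
      · rw [Function.update_of_ne hk, hψk k fun s hs => by rw [hck k hk]]
    have hadm := IsAdmissible.of_eq_off hT (fun u _ => G.contDiff_dynamics.contDiffAt) hφ.1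
      hψC hψint ha hab hoff
    have htraj : IsTrajectory G.dynamics G.T ψ t₀ x₀ (Y ε) := by
      refine ⟨?_, fun s hs => ⟨hYpos s hs, ?_⟩⟩
      · simp [Y, hη₁ t₀ ht₁.le, hy.1]
      · have : G.dynamics (ψ.at s (Y ε s)) = G.dynamics (φ.at s (y s)) + ε * deriv η s := by
          rw [hdyn, G.dynamics_eq i]
          show -(ψ i s (Y ε s) + ψ j s (Y ε s)) = _
          rw [hψc i s hs, hψc j s hs, hci, hck j (one_sub_ne i)]
          simp only [Cc, A]
          ring
        rw [this]
        exact (hy.2 s hs).2.add ((hηd s).hasDerivWithinAt.const_mul ε)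
    have hineq := hφ.2 i (ψ i) (by rw [hψeq]; exact hadm) t₀ ⟨ht₀.1, hle⟩ x₀ hx₀ y (Y ε) hy
      (by rw [hψeq]; exact htraj)
    rw [hψeq] at hineq
    have e1 : payoffAlong (G.utility i) (G.bequest i) G.T ψ t₀ (Y ε) =
        (∫ s in t₀..G.T, P ε s) + G.bequest i (Y ε G.T) := by
      unfold payoffAlong
      congr 1
      refine intervalIntegral.integral_congr fun s hs => ?_
      rw [uIcc_of_le hle] at hs
      show G.own i (ψ i s (Y ε s)) + G.ext i (ψ j s (Y ε s)) = _
      rw [hψc i s hs, hψc j s hs, hci, hck j (one_sub_ne i)]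
    have e2 : payoffAlong (G.utility i) (G.bequest i) G.T φ t₀ y =
        (∫ s in t₀..G.T, P 0 s) + G.bequest i (Y 0 G.T) := by
      unfold payoffAlong
      have hY0 : ∀ s, Y 0 s = y s := fun s => by simp [Y]
      rw [hY0]
      congr 1
      refine intervalIntegral.integral_congr fun s hs => ?_
      show G.own i (φ i s (y s)) + G.ext i (φ j s (y s)) = G.own i (Cc 0 s) + _
      rw [hC0, hY0]
    rw [e1, e2] at hineq
    exact hineq
  have hz := hmax.hasDerivAt_eq_zero hJ
  have hP'0 : ∀ s, P' 0 s = deriv (G.own i) (φ i s (y s)) *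
        (-deriv η s - stockDeriv G.T (φ j) s (y s) * η s) +
        deriv (G.ext i) (φ j s (y s)) * (stockDeriv G.T (φ j) s (y s) * η s) := fun s => by
    have hY0 : Y 0 s = y s := by simp [Y]
    simp only [P', hC0, hY0]
  simp only [hP'0] at hz
  exact hz

/-- Every node lies on a trajectory that starts before the end of the horizon. -/
theorem exists_solution_through {Γ : ℝ → ℝ → ℝ} {T : ℝ} (hT : 0 < T)
    (hΓ : ContDiffOn ℝ 1 (fun p : ℝ × ℝ => Γ p.1 p.2) (nodes T)) (h : WellPosed Γ T)
    {t x : ℝ} (ht : t ∈ Icc 0 T) (hx : 0 < x) :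
    ∃ t₀ ∈ Ico 0 T, ∃ x₀ > 0, ∃ y, SolvesField Γ T t₀ x₀ y ∧ t ∈ Icc t₀ T ∧ y t = x := by
  rcases ht.2.lt_or_eq with hlt | rfl
  · obtain ⟨y, hy, -⟩ := h t ht x hx
    exact ⟨t, ⟨ht.1, hlt⟩, x, hx, y, hy, ⟨le_rfl, ht.2⟩, hy.1⟩
  -- A terminal node is reached by solving backwards, with the right endpoint as the initial time.
  · obtain ⟨C, hC⟩ := exists_bound_field hΓ (m := x / 2) (M := 3 * x / 2) (by positivity)
    obtain ⟨δ, hδ, hδt, hCδ⟩ : ∃ δ > 0, δ ≤ t ∧ C * δ ≤ x / 2 := by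
      refine ⟨min t (x / 2 / (C + 1)), by positivity, min_le_left _ _, ?_⟩
      refine (mul_le_mul_of_nonneg_left (min_le_right _ _) C.coe_nonneg).trans ?_
      rw [mul_div_assoc', div_le_iff₀ (by positivity)]
      nlinarith [C.coe_nonneg]
    obtain ⟨y, hyt, hy⟩ := exists_local_solution hT hΓ (x := x) (r := x / 2) (C := C)
      (by positivity) (by linarith)
      (fun s hs z hz => hC s hs z ⟨by linarith [hz.1], by linarith [hz.2]⟩)
      (t₁ := t - δ) (t₂ := t) (t₀ := t) (by linarith) le_rfl ⟨by linarith, le_rfl⟩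
      (by rwa [sub_sub_cancel])
    have hle : t - δ ≤ t := by linarith
    exact ⟨t - δ, ⟨by linarith, by linarith⟩, y (t - δ), (hy _ ⟨le_rfl, hle⟩).1, y,
      ⟨rfl, hy⟩, ⟨hle, le_rfl⟩, hyt⟩

/-- The left-hand side of the Euler–Lagrange equation of player `i`. -/
noncomputable def eulerLagrange (G : AdditiveDuopoly) (φ : FeedbackProfile) (i : Fin 2)
    (t x : ℝ) : ℝ :=
  deriv (deriv (G.own i)) (φ i t x) *
      (timeDeriv G.T (φ i) t x + stockDeriv G.T (φ i) t x * G.dynamics (φ.at t x)) +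
    (deriv (G.ext i) (φ (1 - i) t x) - deriv (G.own i) (φ i t x)) *
      stockDeriv G.T (φ (1 - i)) t x

theorem continuousOn_eulerLagrange (G : AdditiveDuopoly) (φ : FeedbackProfile)
    (hφC : ∀ i, ContDiffOn ℝ 1 (fun p : ℝ × ℝ => φ i p.1 p.2) (nodes G.T))
    (hint : ∀ i, ∀ t ∈ Icc 0 G.T, ∀ x ∈ Ioi (0 : ℝ), φ i t x ∈ interior (G.U i)) (i : Fin 2) :
    ContinuousOn (fun p : ℝ × ℝ => eulerLagrange G φ i p.1 p.2) (nodes G.T) := by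
  have hT := G.T_pos
  have hcomp : ∀ {f : ℝ → ℝ} (k : Fin 2), (∀ w ∈ interior (G.U k), ContinuousAt f w) →
      ContinuousOn (fun p : ℝ × ℝ => f (φ k p.1 p.2)) (nodes G.T) := fun k hf q hq =>
    (hf _ (hint k q.1 hq.1 q.2 hq.2)).comp_continuousWithinAt
      (f := fun p : ℝ × ℝ => φ k p.1 p.2) ((hφC k).continuousOn q hq)
  have hdyn : ContinuousOn (fun p : ℝ × ℝ => G.dynamics (φ.at p.1 p.2)) (nodes G.T) :=
    (contDiffOn_field (fun u _ => G.contDiff_dynamics.contDiffAt) hφC hint).continuousOn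
  refine ((hcomp i fun w hw => ?_).mul ((continuousOn_timeDeriv hT (hφC i)).add
    ((continuousOn_stockDeriv hT (hφC i)).mul hdyn))).add
    (((hcomp (1 - i) fun w hw => ?_).sub (hcomp i fun w hw => ?_)).mul
      (continuousOn_stockDeriv hT (hφC (1 - i))))
  · have := contDiffAt_deriv (contDiffAt_own G i hw)
    exact (this.derivWithin (m := 0) (by simp)).continuousAt
  · exact (contDiffAt_deriv (contDiffAt_ext G i hw)).continuousAt
  · exact (contDiffAt_deriv (contDiffAt_own G i hw)).continuousAt

/-- Integration by parts removes `η'` from the first variation; the boundary term at `t₀` is zero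
because `η` vanishes there. Variations with `η T = 0` give the differential equation, and one with
`η T > 0` then gives the terminal condition. -/
theorem eulerLagrange_along (G : AdditiveDuopoly) (φ : FeedbackProfile) (hφ : G.IsMPNE φ)
    (hint : ∀ i, ∀ t ∈ Icc 0 G.T, ∀ x ∈ Ioi (0 : ℝ), φ i t x ∈ interior (G.U i)) (i : Fin 2)
    {t₀ x₀ : ℝ} (ht₀ : t₀ ∈ Ico 0 G.T) (hx₀ : 0 < x₀) {y : ℝ → ℝ}
    (hy : IsTrajectory G.dynamics G.T φ t₀ x₀ y) :
    (∀ s ∈ Icc t₀ G.T, eulerLagrange G φ i s (y s) = 0) ∧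
      deriv (G.own i) (φ i G.T (y G.T)) = deriv (G.bequest i) (y G.T) := by
  have hT := G.T_pos
  have hφC := hφ.1.1
  have hle : t₀ ≤ G.T := ht₀.2.le
  have hpos : ∀ s ∈ Icc t₀ G.T, 0 < y s := fun s hs => (hy.2 s hs).1
  have hyc : ContinuousOn y (Icc t₀ G.T) := fun s hs => (hy.2 s hs).2.continuousWithinAt
  have hnode : ∀ s ∈ Icc t₀ G.T, s ∈ Icc 0 G.T := fun s hs => ⟨ht₀.1.trans hs.1, hs.2⟩
  have hR : ContinuousOn (fun s => eulerLagrange G φ i s (y s)) (Icc t₀ G.T) :=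
    continuousOn_along (continuousOn_eulerLagrange G φ hφC hint i) ht₀.1 hyc hpos
  let a : ℝ → ℝ := fun s => deriv (G.own i) (φ i s (y s))
  let a' : ℝ → ℝ := fun s => deriv (deriv (G.own i)) (φ i s (y s)) *
      (timeDeriv G.T (φ i) s (y s) + stockDeriv G.T (φ i) s (y s) * G.dynamics (φ.at s (y s)))
  have had : ∀ s ∈ Icc t₀ G.T, HasDerivWithinAt a (a' s) (Icc t₀ G.T) s := by
    intro s hs
    have h1 := hasDerivWithinAt_along (hφC i) ht₀.1 hs hpos (hy.2 s hs).2
    have h2 := ((contDiffAt_deriv (contDiffAt_own G i (hint i s (hnode s hs) _ (hpos s hs)))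
      ).differentiableAt one_ne_zero).hasDerivAt
    exact h2.comp_hasDerivWithinAt s h1
  have hac : ContinuousOn a (Icc t₀ G.T) := fun s hs => (had s hs).continuousWithinAt
  have hcw : ∀ {f : ℝ → ℝ} (k : Fin 2), (∀ w ∈ interior (G.U k), ContinuousAt f w) →
      ContinuousOn (fun s => f (φ k s (y s))) (Icc t₀ G.T) := fun k hf s hs =>
    (hf _ (hint k s (hnode s hs) _ (hpos s hs))).comp_continuousWithinAt
      (f := fun s => φ k s (y s))
      (continuousOn_along (hφC k).continuousOn ht₀.1 hyc hpos s hs)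
  have hextc : ContinuousOn (fun s => deriv (G.ext i) (φ (1 - i) s (y s))) (Icc t₀ G.T) :=
    hcw (1 - i) fun w hw => (contDiffAt_deriv (contDiffAt_ext G i hw)).continuousAt
  have hqc : ContinuousOn (fun s => stockDeriv G.T (φ (1 - i)) s (y s)) (Icc t₀ G.T) :=
    continuousOn_along (continuousOn_stockDeriv hT (hφC (1 - i))) ht₀.1 hyc hpos
  -- Apart from `a'`, every term of the Euler–Lagrange expression is already known to be continuous,
  -- as is the expression itself.
  have ha'c : ContinuousOn a' (Icc t₀ G.T) := by
    refine (hR.sub ((hextc.sub hac).mul hqc)).congr fun s hs => ?_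
    simp only [a', a, eulerLagrange, Pi.sub_apply, Pi.mul_apply]
    ring
  -- the variation formula after integration by parts
  have hvar : ∀ η : ℝ → ℝ, ContDiff ℝ ∞ η → ∀ t₁, t₀ < t₁ → (∀ s ≤ t₁, η s = 0) →
      (∫ s in t₀..G.T, eulerLagrange G φ i s (y s) * η s) +
        (deriv (G.bequest i) (y G.T) - a G.T) * η G.T = 0 := by
    intro η hη t₁ ht₁ hη₁
    have h1 := firstVariation_eq_zero G φ hφ hint i ht₀ hx₀ hy hη ht₁ hη₁
    have hηc : Continuous η := hη.continuous
    have hη'c : Continuous (deriv η) := (contDiff_infty_iff_deriv.1 hη).2.continuous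
    have hint' : ∀ {f : ℝ → ℝ}, ContinuousOn f (Icc t₀ G.T) →
        IntervalIntegrable f MeasureTheory.volume t₀ G.T := fun hf =>
      (hf.mono (by rw [uIcc_of_le hle])).intervalIntegrable
    have hparts : ∫ s in t₀..G.T, (a' s * η s + a s * deriv η s) = a G.T * η G.T := by
      have := intervalIntegral.integral_eq_sub_of_hasDerivAt_of_le hle
        (f := fun s => a s * η s) (f' := fun s => a' s * η s + a s * deriv η s)
        (hac.mul hηc.continuousOn) (fun s hs => ?_)
        (hint' ((ha'c.mul hηc.continuousOn).add (hac.mul hη'c.continuousOn)))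
      · rw [this, hη₁ t₀ ht₁.le, mul_zero, sub_zero]
      · exact ((had s (Ioo_subset_Icc_self hs)).hasDerivAt (Icc_mem_nhds hs.1 hs.2)).mul
          ((hη.differentiable (by simp) s).hasDerivAt)
    have hsum : ∫ s in t₀..G.T, eulerLagrange G φ i s (y s) * η s =
        (∫ s in t₀..G.T, (deriv (G.own i) (φ i s (y s)) *
          (-deriv η s - stockDeriv G.T (φ (1 - i)) s (y s) * η s) +
          deriv (G.ext i) (φ (1 - i) s (y s)) * (stockDeriv G.T (φ (1 - i)) s (y s) * η s))) +
        ∫ s in t₀..G.T, (a' s * η s + a s * deriv η s) := by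
      rw [← intervalIntegral.integral_add]
      · refine intervalIntegral.integral_congr fun s _ => ?_
        simp only [eulerLagrange, a, a']
        ring
      · refine hint' ((hac.mul (hη'c.continuousOn.neg.sub (hqc.mul hηc.continuousOn))).add
          (hextc.mul (hqc.mul hηc.continuousOn)))
      · exact hint' ((ha'c.mul hηc.continuousOn).add (hac.mul hη'c.continuousOn))
    rw [hsum, hparts]
    linarith
  have hzero : ∀ s ∈ Icc t₀ G.T, eulerLagrange G φ i s (y s) = 0 := by
    refine eq_zero_of_forall_integral_mul_eq_zero ht₀.2 hR fun η hη t₁ ht₁ hη₁ hηT => ?_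
    have := hvar η hη t₁ ht₁.1 hη₁
    rwa [hηT, mul_zero, add_zero] at this
  refine ⟨hzero, ?_⟩
  have ht₁ : (t₀ + G.T) / 2 ∈ Ioo t₀ G.T := ⟨by linarith [ht₀.2], by linarith [ht₀.2]⟩
  -- This variation is zero up to the midpoint of `[t₀, T]` and positive at `T`.
  have h := hvar (fun s => Real.smoothTransition (s - (t₀ + G.T) / 2))
    (Real.smoothTransition.contDiff.comp (contDiff_id.sub contDiff_const)) _ ht₁.1
    fun s hs => Real.smoothTransition.zero_of_nonpos (by linarith)
  have h0 : ∫ s in t₀..G.T, eulerLagrange G φ i s (y s) *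
      Real.smoothTransition (s - (t₀ + G.T) / 2) = 0 := by
    rw [← intervalIntegral.integral_zero (a := t₀) (b := G.T)]
    refine intervalIntegral.integral_congr fun s hs => ?_
    rw [uIcc_of_le hle] at hs
    simp only [hzero s hs, zero_mul]
  rw [h0, zero_add] at h
  have hpos' := Real.smoothTransition.pos_of_pos (x := G.T - (t₀ + G.T) / 2) (by linarith [ht₁.2])
  have := (mul_eq_zero.1 h).resolve_right hpos'.ne'
  show a G.T = _
  linarith

theorem wellPosed_dynamics {g : Controls → ℝ} {T : ℝ} {U : Fin 2 → Set ℝ} {φ : FeedbackProfile}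
    (h : IsAdmissible g T U φ) : WellPosed (fun s x => g (φ.at s x)) T := h.2.2

theorem eulerLagrange_eq_zero (G : AdditiveDuopoly) (φ : FeedbackProfile) (hφ : G.IsMPNE φ)
    (hint : ∀ i, ∀ t ∈ Icc 0 G.T, ∀ x ∈ Ioi (0 : ℝ), φ i t x ∈ interior (G.U i)) (i : Fin 2)
    {t x : ℝ} (ht : t ∈ Icc 0 G.T) (hx : 0 < x) : eulerLagrange G φ i t x = 0 := by
  obtain ⟨t₀, ht₀, x₀, hx₀, y, hy, hty, rfl⟩ := exists_solution_through G.T_pos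
    (contDiffOn_field (fun u _ => G.contDiff_dynamics.contDiffAt) hφ.1.1 hint)
    (wellPosed_dynamics hφ.1) ht hx
  exact (eulerLagrange_along G φ hφ hint i ht₀ hx₀ hy).1 t hty

/-- At the end of the horizon, marginal utility equals the marginal bequest. -/
theorem transversality (G : AdditiveDuopoly) (φ : FeedbackProfile) (hφ : G.IsMPNE φ)
    (hint : ∀ i, ∀ t ∈ Icc 0 G.T, ∀ x ∈ Ioi (0 : ℝ), φ i t x ∈ interior (G.U i)) (i : Fin 2)
    {x : ℝ} (hx : 0 < x) : deriv (G.own i) (φ i G.T x) = deriv (G.bequest i) x := by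
  obtain ⟨t₀, ht₀, x₀, hx₀, y, hy, -, hyx⟩ := exists_solution_through G.T_pos
    (contDiffOn_field (fun u _ => G.contDiff_dynamics.contDiffAt) hφ.1.1 hint)
    (wellPosed_dynamics hφ.1) ⟨G.T_pos.le, le_rfl⟩ hx
  have := (eulerLagrange_along G φ hφ hint i ht₀ hx₀ hy).2
  rwa [hyx] at this

/-! ### Necessary conditions for the monopolist. -/

section PartialDeriv

variable {g : Controls → ℝ} {u : Controls} (i : Fin 2)

theorem hasDerivAt_comp_update {w : ℝ} (hg : DifferentiableAt ℝ g (Function.update u i w)) :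
    HasDerivAt (fun w => g (Function.update u i w))
      (fderiv ℝ g (Function.update u i w) (Pi.single i 1)) w :=
  hg.hasFDerivAt.comp_hasDerivAt w (hasDerivAt_update u i w)

theorem partialDeriv_eq_fderiv (hg : DifferentiableAt ℝ g u) :
    partialDeriv g i u = fderiv ℝ g u (Pi.single i 1) := by
  have h : DifferentiableAt ℝ g (Function.update u i (u i)) := by
    rwa [Function.update_eq_self]
  have := (hasDerivAt_comp_update i h).deriv
  rwa [Function.update_eq_self] at this

theorem contDiffAt_partialDeriv (hg : ContDiffAt ℝ 2 g u) :
    ContDiffAt ℝ 1 (partialDeriv g i) u := by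
  have h1 : ContDiffAt ℝ 1 (fun v => fderiv ℝ g v (Pi.single i 1)) u :=
    (hg.fderiv_right (m := 1) le_rfl).clm_apply contDiffAt_const
  refine h1.congr_of_eventuallyEq ?_
  filter_upwards [hg.eventually (by simp)] with v hv
  exact partialDeriv_eq_fderiv i (hv.differentiableAt two_ne_zero)

end PartialDeriv

theorem contDiffAt_of_pi {g : Controls → ℝ} {U : Fin 2 → Set ℝ}
    (hg : ContDiffOn ℝ 2 g (univ.pi U)) {u : Controls} (hu : ∀ i, u i ∈ interior (U i)) :
    ContDiffAt ℝ 2 g u :=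
  hg.contDiffAt (set_pi_mem_nhds finite_univ fun i _ => mem_interior_iff_mem_nhds.1 (hu i))

/-- Pontryagin's stationarity condition for the monopolist: the costate is the marginal bequest
at the final stock. -/
theorem monopoly_stationary {G : AdditiveDuopoly} (M : MonopolyModel G) (φ : FeedbackProfile)
    (hφ : IsAdmissible G.dynamics G.T G.U φ) (hopt : M.IsOptimal φ)
    (hint : ∀ i, ∀ t ∈ Icc 0 G.T, ∀ x ∈ Ioi (0 : ℝ), φ i t x ∈ interior (G.U i)) (i : Fin 2)
    {t₀ x₀ : ℝ} (ht₀ : t₀ ∈ Ico 0 G.T) (hx₀ : 0 < x₀) {z : ℝ → ℝ}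
    (hz : IsTrajectory M.dynamics G.T φ t₀ x₀ z) :
    ∀ s ∈ Icc t₀ G.T, partialDeriv M.payoff i (φ.at s (z s)) +
      deriv M.bequest (z G.T) * partialDeriv M.dynamics i (φ.at s (z s)) = 0 := by
  have hT := G.T_pos
  have hφC := hφ.1
  have hle : t₀ ≤ G.T := ht₀.2.le
  have hTm : G.T ∈ Icc t₀ G.T := ⟨hle, le_rfl⟩
  have hpos : ∀ s ∈ Icc t₀ G.T, 0 < z s := fun s hs => (hz.2 s hs).1
  have hzc : ContinuousOn z (Icc t₀ G.T) := fun s hs => (hz.2 s hs).2.continuousWithinAt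
  have hnode : ∀ s ∈ Icc t₀ G.T, s ∈ Icc 0 G.T := fun s hs => ⟨ht₀.1.trans hs.1, hs.2⟩
  have hf1 : ∀ u : Controls, (∀ i, u i ∈ interior (G.U i)) → ContDiffAt ℝ 1 M.dynamics u :=
    fun u hu => (contDiffAt_of_pi M.dynamics_smooth hu).of_le (by norm_num)
  have hz1 : ContDiffOn ℝ 1 z (Icc t₀ G.T) := by
    refine contDiffOn_one_of_hasDerivWithinAt ht₀.2 (fun s hs => (hz.2 s hs).2) ?_
    exact continuousOn_along (Φ := fun s x => M.dynamics (φ.at s x))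
      (contDiffOn_field hf1 hφC hint).continuousOn ht₀.1 hzc hpos
  have hφz : ∀ k, ContinuousOn (fun s => φ k s (z s)) (Icc t₀ G.T) := fun k =>
    continuousOn_along (hφC k).continuousOn ht₀.1 hzc hpos
  have hint' : ∀ {f : ℝ → ℝ}, ContinuousOn f (Icc t₀ G.T) →
      IntervalIntegrable f MeasureTheory.volume t₀ G.T := fun hf =>
    (hf.mono (by rw [uIcc_of_le hle])).intervalIntegrable
  have hcwu : ∀ {g : Controls → ℝ},
      (∀ u : Controls, (∀ i, u i ∈ interior (G.U i)) → ContinuousAt g u) →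
      ContinuousOn (fun s => g (φ.at s (z s))) (Icc t₀ G.T) := fun hg s hs =>
    (hg _ fun k => hint k s (hnode s hs) _ (hpos s hs)).comp_continuousWithinAt
      (f := fun s => φ.at s (z s)) (continuousWithinAt_pi.2 fun k => hφz k s hs)
  have hpay2 : ∀ u : Controls, (∀ i, u i ∈ interior (G.U i)) → ContDiffAt ℝ 2 M.payoff u :=
    fun u hu => contDiffAt_of_pi M.payoff_smooth hu
  have hdyn2 : ∀ u : Controls, (∀ i, u i ∈ interior (G.U i)) → ContDiffAt ℝ 2 M.dynamics u :=
    fun u hu => contDiffAt_of_pi M.dynamics_smooth hu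
  have hpayi := hcwu fun u hu => (contDiffAt_partialDeriv i (hpay2 u hu)).continuousAt
  have hdyni := hcwu fun u hu => (contDiffAt_partialDeriv i (hdyn2 u hu)).continuousAt
  refine eq_zero_of_forall_integral_mul_eq_zero ht₀.2 (hpayi.add (continuousOn_const.mul hdyni)) ?_
  intro η hη t₁ ht₁ hη₁ _
  have hηc : Continuous η := hη.continuous
  -- An open-loop variation: only control `i` along the given path moves. It becomes a feedback
  -- deviation below.
  let C : ℝ → ℝ → Controls := fun ε s =>
    Function.update (φ.at s (z s)) i (φ i s (z s) + ε * η s)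
  have hCi : ∀ ε s, C ε s i = φ i s (z s) + ε * η s := fun ε s => Function.update_self _ _ _
  have hCk : ∀ ε s k, k ≠ i → C ε s k = φ k s (z s) := fun ε s k hk =>
    Function.update_of_ne hk _ _
  have hC0 : ∀ s, C 0 s = φ.at s (z s) := fun s => by
    simp only [C, zero_mul, add_zero]
    exact Function.update_eq_self _ _
  have hC1 : ∀ ε s, s ≤ t₁ → C ε s = φ.at s (z s) := fun ε s hs => by
    simp only [C, hη₁ s hs, mul_zero, add_zero]
    exact Function.update_eq_self _ _
  have hthick : ∃ δ > 0, ∀ s ∈ Icc t₀ G.T, ∀ w, |w - φ i s (z s)| ≤ δ → w ∈ interior (G.U i) := by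
    have hK := (isCompact_Icc (a := t₀) (b := G.T)).image_of_continuousOn (hφz i)
    obtain ⟨δ, hδ, hδs⟩ := hK.exists_cthickening_subset_open isOpen_interior (by
      rintro _ ⟨s, hs, rfl⟩
      exact hint i s (hnode s hs) _ (hpos s hs))
    refine ⟨δ, hδ, fun s hs w hw => hδs ?_⟩
    exact mem_cthickening_of_dist_le _ (φ i s (z s)) _ _ ⟨s, hs, rfl⟩ hw
  obtain ⟨δ₁, hδ₁, hthick⟩ := hthick
  have hεη : ∀ δ > 0, ∀ᶠ ε in 𝓝 (0 : ℝ), ∀ s ∈ Icc t₀ G.T, |ε * η s| ≤ δ := fun δ hδ =>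
    eventually_abs_le_of_continuousOn (D := fun ε s => ε * η s) one_pos (by fun_prop)
      (fun s _ => by simp) hδ
  obtain ⟨e, he, hin⟩ : ∃ e > 0, ∀ ε ∈ Icc (-e) e, ∀ s ∈ Icc t₀ G.T, ∀ k,
      C ε s k ∈ interior (G.U k) := by
    obtain ⟨κ, hκ, hκ'⟩ := Metric.eventually_nhds_iff.1 (hεη δ₁ hδ₁)
    refine ⟨κ / 2, by positivity, fun ε hε s hs k => ?_⟩
    by_cases hk : k = i
    · rw [hk, hCi]
      refine hthick s hs _ ?_
      rw [add_sub_cancel_left]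
      refine hκ' ?_ s hs
      rw [Real.dist_eq, sub_zero]
      linarith [abs_le.2 hε]
    · rw [hCk ε s k hk]
      exact hint k s (hnode s hs) _ (hpos s hs)
  have hcw : ∀ {g : Controls → ℝ},
      (∀ u : Controls, (∀ i, u i ∈ interior (G.U i)) → ContinuousAt g u) →
      ContinuousOn (fun q : ℝ × ℝ => g (C q.1 q.2)) (Icc (-e) e ×ˢ Icc t₀ G.T) := by
    intro g hg q hq
    refine (hg _ (hin q.1 hq.1 q.2 hq.2)).comp_continuousWithinAt
      (f := fun q : ℝ × ℝ => C q.1 q.2) (continuousWithinAt_pi.2 fun k => ?_)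
    have hk2 : ∀ k, ContinuousOn (fun q : ℝ × ℝ => φ k q.2 (z q.2)) (Icc (-e) e ×ˢ Icc t₀ G.T) :=
      fun k => (hφz k).comp continuousOn_snd fun q hq => hq.2
    by_cases hk : k = i
    · subst hk
      simp only [hCi]
      exact ((hk2 k).add (by fun_prop)) q hq
    · simp only [hCk _ _ k hk]
      exact hk2 k q hq
  have hslice : ∀ {P : ℝ → ℝ → ℝ},
      ContinuousOn (fun q : ℝ × ℝ => P q.1 q.2) (Icc (-e) e ×ˢ Icc t₀ G.T) →
      ∀ ε ∈ Icc (-e) e, ContinuousOn (P ε) (Icc t₀ G.T) := fun hP ε hε =>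
    hP.comp (f := fun s : ℝ => (ε, s)) (by fun_prop) fun s hs => ⟨hε, hs⟩
  have h0e : (0 : ℝ) ∈ Icc (-e) e := ⟨by linarith, he.le⟩
  have hvar : ∀ {g : Controls → ℝ},
      (∀ u : Controls, (∀ i, u i ∈ interior (G.U i)) → ContDiffAt ℝ 2 g u) →
      HasDerivAt (fun ε => ∫ s in t₀..G.T, g (C ε s))
        (∫ s in t₀..G.T, partialDeriv g i (φ.at s (z s)) * η s) 0 := by
    intro g hg
    have := hasDerivAt_integral_of_continuousOn hle he (P := fun ε s => g (C ε s))
      (P' := fun ε s => partialDeriv g i (C ε s) * η s)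
      (hslice (hcw fun u hu => (hg u hu).continuousAt))
      ((hcw fun u hu => (contDiffAt_partialDeriv i (hg u hu)).continuousAt).mul (by fun_prop))
      (fun s hs ε hε => by
        have hd : DifferentiableAt ℝ g (C ε s) :=
          (hg _ (hin ε hε s hs)).differentiableAt two_ne_zero
        have h1 := hasDerivAt_comp_update i hd
        rw [show Function.update (φ.at s (z s)) i (φ i s (z s) + ε * η s) = C ε s from rfl,
          ← partialDeriv_eq_fderiv i hd] at h1
        have h2 := ((hasDerivAt_id ε).mul_const (η s)).const_add (φ i s (z s))
        rw [one_mul] at h2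
        exact h1.comp ε h2)
    simpa only [hC0] using this
  -- The dynamics depend on the controls only, so the perturbed state is a plain integral. This is
  -- why the stock enters the first variation only through the bequest and the costate is constant.
  let Z : ℝ → ℝ → ℝ := fun ε s => x₀ + ∫ r in t₀..s, M.dynamics (C ε r)
  have hfC : ∀ ε ∈ Icc (-e) e, ContinuousOn (fun s => M.dynamics (C ε s)) (Icc t₀ G.T) :=
    hslice (hcw fun u hu => (hdyn2 u hu).continuousAt)
  have hZd : ∀ ε ∈ Icc (-e) e, ∀ s ∈ Icc t₀ G.T,
      HasDerivWithinAt (Z ε) (M.dynamics (C ε s)) (Icc t₀ G.T) s := by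
    intro ε hε s hs
    exact ODE.hasDerivWithinAt_picard_Icc (f := fun r _ => M.dynamics (C ε r)) (u := univ)
      (t₀ := t₀) (α := fun _ => (0 : ℝ)) ⟨le_rfl, hle⟩
      ((hfC ε hε).comp continuousOn_fst fun q hq => hq.1) continuousOn_const
      (fun _ _ => mem_univ _) x₀ hs
  have hz0 : ∀ s ∈ Icc t₀ G.T, z s = Z 0 s := by
    intro s hs
    have := intervalIntegral.integral_eq_sub_of_hasDerivAt_of_le hs.1
      (f := z) (f' := fun r => M.dynamics (C 0 r)) (hzc.mono (Icc_subset_Icc_right hs.2))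
      (fun r hr => ?_) ?_
    · simp only [Z, this, hz.1]
      ring
    · rw [hC0]
      exact (hz.2 r ⟨hr.1.le, hr.2.le.trans hs.2⟩).2.hasDerivAt
        (Icc_mem_nhds hr.1 (hr.2.trans_le hs.2))
    · refine ((hfC 0 h0e).mono ?_).intervalIntegrable
      rw [uIcc_of_le hs.1]
      exact Icc_subset_Icc_right hs.2
  have hZz : ∀ δ > 0, ∀ᶠ ε in 𝓝 (0 : ℝ), ∀ s ∈ Icc t₀ G.T, |Z ε s - z s| ≤ δ := by
    intro δ hδ
    have hdc := hcw fun u hu => (hdyn2 u hu).continuousAt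
    have := eventually_abs_le_of_continuousOn
      (D := fun ε s => M.dynamics (C ε s) - M.dynamics (C 0 s)) he
      (hdc.sub ((hfC 0 h0e).comp continuousOn_snd fun q hq => hq.2)) (fun s _ => sub_self _)
      (δ := δ / G.T) (by positivity)
    filter_upwards [this, Icc_mem_nhds (neg_lt_zero.2 he) he] with ε h1 hε s hs
    have hsub : uIcc t₀ s ⊆ Icc t₀ G.T := by
      rw [uIcc_of_le hs.1]; exact Icc_subset_Icc_right hs.2
    have e1 : Z ε s - z s = ∫ r in t₀..s, (M.dynamics (C ε r) - M.dynamics (C 0 r)) := by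
      rw [hz0 s hs, intervalIntegral.integral_sub ((hfC ε hε).mono hsub).intervalIntegrable
        ((hfC 0 h0e).mono hsub).intervalIntegrable]
      simp only [Z]
      ring
    rw [e1, ← Real.norm_eq_abs]
    refine (intervalIntegral.norm_integral_le_of_norm_le_const (C := δ / G.T) fun r hr =>
      h1 r (hsub (uIoc_subset_uIcc hr))).trans ?_
    rw [abs_of_nonneg (sub_nonneg.2 hs.1), div_mul_eq_mul_div, div_le_iff₀ hT]
    exact mul_le_mul_of_nonneg_left (by linarith [hs.2, ht₀.1]) hδ.le
  have hJ : HasDerivAt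
      (fun ε => (∫ s in t₀..G.T, M.payoff (C ε s)) + M.bequest (Z ε G.T))
      ((∫ s in t₀..G.T, partialDeriv M.payoff i (φ.at s (z s)) * η s) +
        deriv M.bequest (z G.T) *
          ∫ s in t₀..G.T, partialDeriv M.dynamics i (φ.at s (z s)) * η s) 0 := by
    refine (hvar hpay2).add ?_
    have hb : HasDerivAt M.bequest (deriv M.bequest (z G.T)) (Z 0 G.T) := by
      rw [← hz0 _ hTm]
      exact ((M.bequest_smooth.contDiffAt (Ioi_mem_nhds (hpos _ hTm))).differentiableAt
        two_ne_zero).hasDerivAt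
    exact hb.comp 0 ((hvar hdyn2).const_add x₀)
  have hmax : IsLocalMax (fun ε => (∫ s in t₀..G.T, M.payoff (C ε s)) + M.bequest (Z ε G.T)) 0 := by
    obtain ⟨δ, hδ, hdev⟩ := exists_deviation hφC hint ht₀.1 ht₁.1 hzc hpos
    -- The tolerance in `exists_deviation` compares the new controls with `φ` on the new path, so `φ
    -- k` must move little when the stock does. The constant variation `η = 1` supplies a modulus
    -- uniform in time.
    have hmod : ∀ k, ∃ κ > 0, ∀ ζ, |ζ| ≤ κ → ∀ s ∈ Icc t₀ G.T,
        |φ k s (z s + ζ * 1) - φ k s (z s)| ≤ δ / 2 := by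
      intro k
      obtain ⟨e₀, he₀, hpos₀⟩ := exists_pos_margin (η := fun _ => 1) hzc hpos continuousOn_const
      have := eventually_abs_le_of_continuousOn
        (D := fun ζ s => φ k s (z s + ζ * 1) - φ k s (z s)) he₀
        ((continuousOn_variation (hφC k).continuousOn ht₀.1 hzc continuous_const hpos₀).sub
          ((hφz k).comp continuousOn_snd fun q hq => hq.2)) (fun s _ => by simp)
        (half_pos hδ)
      obtain ⟨κ, hκ, hκ'⟩ := Metric.eventually_nhds_iff.1 this
      refine ⟨κ / 2, by positivity, fun ζ hζ => hκ' ?_⟩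
      rw [Real.dist_eq, sub_zero]
      linarith
    choose κ hκ hκ' using hmod
    filter_upwards [hεη (δ / 2) (half_pos hδ), hZz δ hδ, hZz (κ 0) (hκ 0), hZz (κ 1) (hκ 1),
      Icc_mem_nhds (neg_lt_zero.2 he) he] with ε h1 h2 h3 h4 hε
    have hclose : ∀ k, ∀ s ∈ Icc t₀ G.T, |φ k s (Z ε s) - φ k s (z s)| ≤ δ / 2 := by
      intro k s hs
      have hk : |Z ε s - z s| ≤ κ k := by
        fin_cases k
        · exact h3 s hs
        · exact h4 s hs
      simpa using hκ' k _ hk s hs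
    have hZ1 : ∀ s ∈ Icc t₀ G.T, s ≤ t₁ → Z ε s = z s := by
      intro s hs hs1
      rw [hz0 s hs]
      simp only [Z]
      congr 1
      refine intervalIntegral.integral_congr fun r hr => ?_
      rw [uIcc_of_le hs.1] at hr
      simp only [hC1 ε r (hr.2.trans hs1), hC0]
    obtain ⟨ψ, hψC, hψint, ⟨a, b, ha, hab, hoff⟩, hZpos, hψc, -⟩ := hdev (Z ε) (fun k s => C ε s k)
      (contDiffOn_one_of_hasDerivWithinAt ht₀.2 (hZd ε hε) (hfC ε hε))
      (by
        intro k
        by_cases hk : k = i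
        · subst hk
          simp only [hCi]
          exact (contDiffOn_along (hφC k) ht₀.1 hz1 hpos).add
            (contDiffOn_const.mul (hη.of_le (by simp)).contDiffOn)
        · simp only [hCk _ _ k hk]
          exact contDiffOn_along (hφC k) ht₀.1 hz1 hpos) h2
      (by
        intro k s hs
        have ha : |C ε s k - φ k s (z s)| ≤ δ / 2 := by
          by_cases hk : k = i
          · subst hk
            rw [hCi, add_sub_cancel_left]
            exact h1 s hs
          · rw [hCk _ _ k hk, sub_self, abs_zero]
            positivity
        have := abs_le.1 ha
        have := abs_le.1 (hclose k s hs)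
        refine abs_le.2 ⟨by linarith, by linarith⟩)
      (by
        intro k s hs hs1
        simp only [hC1 ε s hs1, hZ1 s hs hs1]
        rfl)
    have hat : ∀ s ∈ Icc t₀ G.T, ψ.at s (Z ε s) = C ε s := fun s hs => funext fun k => hψc k s hs
    have htraj : IsTrajectory M.dynamics G.T ψ t₀ x₀ (Z ε) := by
      refine ⟨by simp [Z], fun s hs => ⟨hZpos s hs, ?_⟩⟩
      rw [hat s hs]
      exact hZd ε hε s hs
    -- The monopolist competes with profiles admissible for both dynamics; one change on a compact
    -- stock interval preserves both.
    have hineq := hopt.2 ψ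
      (IsAdmissible.of_eq_off hT (fun u _ => G.contDiff_dynamics.contDiffAt) hφ hψC hψint ha hab
        hoff)
      (IsAdmissible.of_eq_off hT hf1 hopt.1 hψC hψint ha hab hoff) t₀ ⟨ht₀.1, hle⟩ x₀ hx₀ z (Z ε)
      hz htraj
    have e1 : payoffAlong M.payoff M.bequest G.T ψ t₀ (Z ε) =
        (∫ s in t₀..G.T, M.payoff (C ε s)) + M.bequest (Z ε G.T) := by
      unfold payoffAlong
      congr 1
      refine intervalIntegral.integral_congr fun s hs => ?_
      rw [uIcc_of_le hle] at hs
      simp only [hat s hs]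
    have e2 : payoffAlong M.payoff M.bequest G.T φ t₀ z =
        (∫ s in t₀..G.T, M.payoff (C 0 s)) + M.bequest (Z 0 G.T) := by
      unfold payoffAlong
      rw [← hz0 _ hTm]
      simp only [hC0]
    rw [e1, e2] at hineq
    exact hineq
  have hzero := hmax.hasDerivAt_eq_zero hJ
  have hI1 : IntervalIntegrable (fun s => partialDeriv M.payoff i (φ.at s (z s)) * η s)
      MeasureTheory.volume t₀ G.T := hint' (hpayi.mul hηc.continuousOn)
  have hI2 : IntervalIntegrable (fun s => deriv M.bequest (z G.T) *
      (partialDeriv M.dynamics i (φ.at s (z s)) * η s)) MeasureTheory.volume t₀ G.T :=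
    hint' (continuousOn_const.mul (hdyni.mul hηc.continuousOn))
  rw [← intervalIntegral.integral_const_mul, ← intervalIntegral.integral_add hI1 hI2] at hzero
  rw [← hzero]
  refine intervalIntegral.integral_congr fun s _ => ?_
  ring

/-! ### Chain rule along a profile, and the equilibrium system. -/

section Chain

variable {T : ℝ} {φ : FeedbackProfile} {h : Controls → ℝ} {t x : ℝ}

/-- The direction `v` is arbitrary so that `(1, 0)` and `(0, 1)` yield the time and stock versions.
-/
theorem fderivWithin_comp_profile (hT : 0 < T)
    (hφ : ∀ i, ContDiffOn ℝ 1 (fun p : ℝ × ℝ => φ i p.1 p.2) (nodes T)) (ht : t ∈ Icc 0 T)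
    (hx : 0 < x) (hh : DifferentiableAt ℝ h (φ.at t x)) (v : ℝ × ℝ) :
    fderivWithin ℝ (fun p : ℝ × ℝ => h (φ.at p.1 p.2)) (nodes T) (t, x) v =
      partialDeriv h 0 (φ.at t x) *
          fderivWithin ℝ (fun p : ℝ × ℝ => φ 0 p.1 p.2) (nodes T) (t, x) v +
        partialDeriv h 1 (φ.at t x) *
          fderivWithin ℝ (fun p : ℝ × ℝ => φ 1 p.1 p.2) (nodes T) (t, x) v := by
  have hpi : HasFDerivWithinAt (fun p : ℝ × ℝ => φ.at p.1 p.2)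
      (ContinuousLinearMap.pi fun k =>
        fderivWithin ℝ (fun p : ℝ × ℝ => φ k p.1 p.2) (nodes T) (t, x)) (nodes T) (t, x) :=
    hasFDerivWithinAt_pi.2 fun k => hasFDerivWithinAt_nodes (hφ k) ht hx
  have hc := HasFDerivAt.comp_hasFDerivWithinAt (f := fun p : ℝ × ℝ => φ.at p.1 p.2) (t, x)
    hh.hasFDerivAt hpi
  have he := hc.fderivWithin (uniqueDiffOn_nodes hT (t, x) ⟨ht, hx⟩)
  have he' : fderivWithin ℝ (fun p : ℝ × ℝ => h (φ.at p.1 p.2)) (nodes T) (t, x) = _ := he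
  rw [he', partialDeriv_eq_fderiv 0 hh, partialDeriv_eq_fderiv 1 hh]
  simp only [ContinuousLinearMap.comp_apply]
  set w : Controls := (ContinuousLinearMap.pi fun k =>
        fderivWithin ℝ (fun p : ℝ × ℝ => φ k p.1 p.2) (nodes T) (t, x)) v with hw
  have hsplit : w = w 0 • (Pi.single 0 1 : Controls) + w 1 • (Pi.single 1 1 : Controls) := by
    funext k
    fin_cases k <;> simp
  rw [hsplit, map_add, map_smul, map_smul, smul_eq_mul, smul_eq_mul, mul_comm (w 0),
    mul_comm (w 1)]
  rfl

theorem timeDeriv_comp_profile (hT : 0 < T)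
    (hφ : ∀ i, ContDiffOn ℝ 1 (fun p : ℝ × ℝ => φ i p.1 p.2) (nodes T)) (ht : t ∈ Icc 0 T)
    (hx : 0 < x) (hh : DifferentiableAt ℝ h (φ.at t x)) :
    timeDeriv T (fun t x => h (φ.at t x)) t x =
      partialDeriv h 0 (φ.at t x) * timeDeriv T (φ 0) t x +
        partialDeriv h 1 (φ.at t x) * timeDeriv T (φ 1) t x :=
  fderivWithin_comp_profile hT hφ ht hx hh (1, 0)

theorem stockDeriv_comp_profile (hT : 0 < T)
    (hφ : ∀ i, ContDiffOn ℝ 1 (fun p : ℝ × ℝ => φ i p.1 p.2) (nodes T)) (ht : t ∈ Icc 0 T)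
    (hx : 0 < x) (hh : DifferentiableAt ℝ h (φ.at t x)) :
    stockDeriv T (fun t x => h (φ.at t x)) t x =
      partialDeriv h 0 (φ.at t x) * stockDeriv T (φ 0) t x +
        partialDeriv h 1 (φ.at t x) * stockDeriv T (φ 1) t x :=
  fderivWithin_comp_profile hT hφ ht hx hh (0, 1)

end Chain

/-- The first-order system satisfied by an interior equilibrium. -/
theorem equilibrium_system (G : AdditiveDuopoly) (φ : FeedbackProfile) (hφ : G.IsMPNE φ)
    (hint : ∀ i, ∀ t ∈ Icc 0 G.T, ∀ x ∈ Ioi (0 : ℝ), φ i t x ∈ interior (G.U i)) (i : Fin 2)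
    {t x : ℝ} (ht : t ∈ Icc 0 G.T) (hx : 0 < x) :
    timeDeriv G.T (φ i) t x + G.dynamics (φ.at t x) * stockDeriv G.T (φ i) t x +
      (G.E i (φ.at t x) - G.Eext i (φ.at t x)) * stockDeriv G.T (φ (1 - i)) t x = 0 := by
  have h := eulerLagrange_eq_zero G φ hφ hint i ht hx
  have hne := (G.own_concave i _ (hint i t ht x hx)).ne
  unfold eulerLagrange at h
  unfold AdditiveDuopoly.E AdditiveDuopoly.Eext
  show _ + (-(deriv (G.own i) (φ i t x) / deriv (deriv (G.own i)) (φ i t x)) -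
    -(deriv (G.ext i) (φ (1 - i) t x) / deriv (deriv (G.own i)) (φ i t x))) * _ = 0
  field_simp
  linear_combination h

/-! ### Costate relations and the slope of the second rule against the first. -/

section Costate

variable {G : AdditiveDuopoly} {M : MonopolyModel G} {φ : FeedbackProfile}

theorem contDiffAt_costate (hreg : M.IsRegularAlong φ)
    (hint : ∀ i, ∀ t ∈ Icc 0 G.T, ∀ x ∈ Ioi (0 : ℝ), φ i t x ∈ interior (G.U i))
    (i : Fin 2) {t x : ℝ} (ht : t ∈ Icc 0 G.T) (hx : 0 < x) :
    ContDiffAt ℝ 1 (M.costate i) (φ.at t x) :=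
  have hu : ∀ k, φ.at t x k ∈ interior (G.U k) := fun k => hint k t ht x hx
  ((contDiffAt_partialDeriv i (contDiffAt_of_pi M.payoff_smooth hu)).div
    (contDiffAt_partialDeriv i (contDiffAt_of_pi M.dynamics_smooth hu)) ((hreg t ht x hx).1 i)).neg

theorem contDiffOn_costate (hreg : M.IsRegularAlong φ)
    (hφC : ∀ i, ContDiffOn ℝ 1 (fun p : ℝ × ℝ => φ i p.1 p.2) (nodes G.T))
    (hint : ∀ i, ∀ t ∈ Icc 0 G.T, ∀ x ∈ Ioi (0 : ℝ), φ i t x ∈ interior (G.U i)) (i : Fin 2) :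
    ContDiffOn ℝ 1 (fun p : ℝ × ℝ => M.costate i (φ.at p.1 p.2)) (nodes G.T) := fun p hp =>
  (contDiffAt_costate hreg hint i hp.1 hp.2).comp_contDiffWithinAt p
    (f := fun p : ℝ × ℝ => φ.at p.1 p.2) (contDiffWithinAt_pi.2 fun k => hφC k p hp)

/-- Along the monopolist's trajectories both costates equal the marginal bequest at the final
stock. -/
theorem costate_along (hreg : M.IsRegularAlong φ) (hφ : IsAdmissible G.dynamics G.T G.U φ)
    (hopt : M.IsOptimal φ)
    (hint : ∀ i, ∀ t ∈ Icc 0 G.T, ∀ x ∈ Ioi (0 : ℝ), φ i t x ∈ interior (G.U i)) (i : Fin 2)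
    {t₀ x₀ : ℝ} (ht₀ : t₀ ∈ Ico 0 G.T) (hx₀ : 0 < x₀) {z : ℝ → ℝ}
    (hz : IsTrajectory M.dynamics G.T φ t₀ x₀ z) {s : ℝ} (hs : s ∈ Icc t₀ G.T) :
    M.costate i (φ.at s (z s)) = deriv M.bequest (z G.T) := by
  have h := monopoly_stationary M φ hφ hopt hint i ht₀ hx₀ hz s hs
  have hne := (hreg s ⟨ht₀.1.trans hs.1, hs.2⟩ (z s) (hz.2 s hs).1).1 i
  unfold MonopolyModel.costate
  rw [← neg_div, div_eq_iff hne]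
  linarith

/-- Through each node runs a trajectory of the monopolist's dynamics along which both costates are
the same constant. Equality is immediate, and differentiating the constant along the trajectory
gives the transport equation. -/
theorem costate_relations (hreg : M.IsRegularAlong φ) (hφ : IsAdmissible G.dynamics G.T G.U φ)
    (hopt : M.IsOptimal φ)
    (hint : ∀ i, ∀ t ∈ Icc 0 G.T, ∀ x ∈ Ioi (0 : ℝ), φ i t x ∈ interior (G.U i))
    {t x : ℝ} (ht : t ∈ Icc 0 G.T) (hx : 0 < x) :
    M.costate 0 (φ.at t x) = M.costate 1 (φ.at t x) ∧
      timeDeriv G.T (fun t x => M.costate 0 (φ.at t x)) t x +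
        stockDeriv G.T (fun t x => M.costate 0 (φ.at t x)) t x * M.dynamics (φ.at t x) = 0 := by
  have hf1 : ∀ u : Controls, (∀ i, u i ∈ interior (G.U i)) → ContDiffAt ℝ 1 M.dynamics u :=
    fun u hu => (contDiffAt_of_pi M.dynamics_smooth hu).of_le (by norm_num)
  obtain ⟨t₀, ht₀, x₀, hx₀, z, hz, hty, rfl⟩ := exists_solution_through G.T_pos
    (contDiffOn_field hf1 hφ.1 hint) (wellPosed_dynamics hopt.1) ht hx
  have hz' : IsTrajectory M.dynamics G.T φ t₀ x₀ z := hz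
  have hc := fun i => fun s (hs : s ∈ Icc t₀ G.T) =>
    costate_along hreg hφ hopt hint i ht₀ hx₀ hz' hs
  refine ⟨by rw [hc 0 t hty, hc 1 t hty], ?_⟩
  have h1 := hasDerivWithinAt_along (Φ := fun s x => M.costate 0 (φ.at s x))
    (contDiffOn_costate hreg hφ.1 hint 0) ht₀.1 hty
    (fun s hs => (hz.2 s hs).1) (hz.2 t hty).2
  have h2 : HasDerivWithinAt (fun s => M.costate 0 (φ.at s (z s))) 0 (Icc t₀ G.T) t :=
    (hasDerivWithinAt_const t _ (deriv M.bequest (z G.T))).congr (hc 0) (hc 0 t hty)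
  exact (uniqueDiffOn_Icc ht₀.2 t hty).eq_deriv _ h1 h2

/-- The difference of the two costates. -/
noncomputable def MonopolyModel.gap (M : MonopolyModel G) (u : Controls) : ℝ :=
  M.costate 0 u - M.costate 1 u

theorem contDiffAt_gap (hreg : M.IsRegularAlong φ)
    (hint : ∀ i, ∀ t ∈ Icc 0 G.T, ∀ x ∈ Ioi (0 : ℝ), φ i t x ∈ interior (G.U i))
    {t x : ℝ} (ht : t ∈ Icc 0 G.T) (hx : 0 < x) : ContDiffAt ℝ 1 M.gap (φ.at t x) :=
  (contDiffAt_costate hreg hint 0 ht hx).sub (contDiffAt_costate hreg hint 1 ht hx)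

theorem gap_eq_zero (hreg : M.IsRegularAlong φ) (hφ : IsAdmissible G.dynamics G.T G.U φ)
    (hopt : M.IsOptimal φ)
    (hint : ∀ i, ∀ t ∈ Icc 0 G.T, ∀ x ∈ Ioi (0 : ℝ), φ i t x ∈ interior (G.U i))
    {t x : ℝ} (ht : t ∈ Icc 0 G.T) (hx : 0 < x) : M.gap (φ.at t x) = 0 :=
  sub_eq_zero.2 (costate_relations hreg hφ hopt hint ht hx).1

/-- The slope of the second rule as a function of the first one. -/
noncomputable def ruleSlope (T : ℝ) (φ : FeedbackProfile) (t x : ℝ) : ℝ :=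
  stockDeriv T (φ 1) t x / stockDeriv T (φ 0) t x

/-- The algebraic consequences of the two first-order systems. -/
theorem slope_relations (hreg : M.IsRegularAlong φ) (hφ : G.IsMPNE φ)
    (hopt : M.IsOptimal φ)
    (hint : ∀ i, ∀ t ∈ Icc 0 G.T, ∀ x ∈ Ioi (0 : ℝ), φ i t x ∈ interior (G.U i))
    {t x : ℝ} (ht : t ∈ Icc 0 G.T) (hx : 0 < x) (hux : stockDeriv G.T (φ 0) t x ≠ 0) :
    (G.E 0 (φ.at t x) - G.Eext 0 (φ.at t x)) * ruleSlope G.T φ t x ^ 2 =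
        G.E 1 (φ.at t x) - G.Eext 1 (φ.at t x) ∧
      (stockDeriv G.T (fun t x => M.costate 0 (φ.at t x)) t x ≠ 0 →
        M.dynamics (φ.at t x) = G.dynamics (φ.at t x) +
          (G.E 0 (φ.at t x) - G.Eext 0 (φ.at t x)) * ruleSlope G.T φ t x) := by
  have hT := G.T_pos
  have hφC := hφ.1.1
  have hgd := (contDiffAt_gap hreg hint ht hx).differentiableAt one_ne_zero
  have hcd := (contDiffAt_costate hreg hint 0 ht hx).differentiableAt one_ne_zero
  -- The gap is zero at every node, so all its derivatives within the set of nodes vanish, including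
  -- the one-sided time derivatives at `0` and `T`.
  have hzero : ∀ v, fderivWithin ℝ (fun p : ℝ × ℝ => M.gap (φ.at p.1 p.2)) (nodes G.T) (t, x) v
      = 0 := by
    intro v
    have : fderivWithin ℝ (fun p : ℝ × ℝ => M.gap (φ.at p.1 p.2)) (nodes G.T) (t, x) =
        fderivWithin ℝ (fun _ : ℝ × ℝ => (0 : ℝ)) (nodes G.T) (t, x) :=
      fderivWithin_congr (fun p hp => gap_eq_zero hreg hφ.1 hopt hint hp.1 hp.2)
        (gap_eq_zero hreg hφ.1 hopt hint ht hx)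
    rw [this]
    simp
  have g2 : partialDeriv M.gap 1 (φ.at t x) ≠ 0 := (hreg t ht x hx).2
  have ht' := (timeDeriv_comp_profile hT hφC ht hx hgd).symm.trans (hzero (1, 0))
  have hx' := (stockDeriv_comp_profile hT hφC ht hx hgd).symm.trans (hzero (0, 1))
  have hm := (costate_relations hreg hφ.1 hopt hint ht hx).2
  rw [timeDeriv_comp_profile hT hφC ht hx hcd] at hm
  rw [stockDeriv_comp_profile hT hφC ht hx hcd] at hm ⊢
  have e0 := equilibrium_system G φ hφ hint 0 ht hx
  have e1 := equilibrium_system G φ hφ hint 1 ht hx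
  simp only [sub_zero, sub_self] at e0 e1
  set τ := ruleSlope G.T φ t x with hτ
  set q0 := stockDeriv G.T (φ 0) t x
  have hq : stockDeriv G.T (φ 1) t x = τ * q0 := by
    rw [hτ, ruleSlope, div_mul_cancel₀ _ hux]
  have hg1 : partialDeriv M.gap 0 (φ.at t x) = -(partialDeriv M.gap 1 (φ.at t x) * τ) := by
    rw [hq] at hx'
    have : (partialDeriv M.gap 0 (φ.at t x) + partialDeriv M.gap 1 (φ.at t x) * τ) * q0 = 0 := by
      linear_combination hx'
    linarith [(mul_eq_zero.1 this).resolve_right hux]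
  have hp : timeDeriv G.T (φ 1) t x = τ * timeDeriv G.T (φ 0) t x := by
    rw [hg1] at ht'
    refine mul_left_cancel₀ g2 ?_
    linear_combination ht'
  rw [hq] at e0 e1 hm ⊢
  rw [hp] at e1 hm
  -- `τ` times the first equilibrium equation minus the second: the time derivative and the terms
  -- with `F` cancel.
  have hmain : ((G.E 0 (φ.at t x) - G.Eext 0 (φ.at t x)) * τ ^ 2 -
      (G.E 1 (φ.at t x) - G.Eext 1 (φ.at t x))) * q0 = 0 := by
    linear_combination τ * e0 - e1
  refine ⟨sub_eq_zero.1 ((mul_eq_zero.1 hmain).resolve_right hux), fun hne => ?_⟩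
  -- The rate of change of γ¹ along a curve of slope `τ` in the control plane; its stock derivative
  -- is `κ * q0`. If that is nonzero, `κ` cancels from the transport equation, leaving u¹_t + f u¹_x
  -- = 0 to be compared with `e0`.
  set κ := partialDeriv (M.costate 0) 0 (φ.at t x) + partialDeriv (M.costate 0) 1 (φ.at t x) * τ
    with hκ
  have hκ0 : κ ≠ 0 := by
    rintro h0
    apply hne
    have : κ * q0 = 0 := by rw [h0, zero_mul]
    rw [hκ] at this
    linear_combination this
  have h1 : κ * (timeDeriv G.T (φ 0) t x + q0 * M.dynamics (φ.at t x)) = 0 := by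
    rw [hκ]
    linear_combination hm
  have h2 := (mul_eq_zero.1 h1).resolve_left hκ0
  refine mul_right_cancel₀ hux ?_
  linear_combination h2 - e0

end Costate

/-! ### From local to global: the second rule as a function of the first. -/

/-- A locally injective map from a connected Hausdorff space to the line that has local sections
through every point is injective. -/
theorem injective_of_local_sections {K : Type*} [TopologicalSpace K] [T2Space K]
    [PreconnectedSpace K] {p : K → ℝ} (hp : Continuous p) (hinj : IsLocallyInjective p)
    (hsec : ∀ k, ∃ I, IsOpen I ∧ IsPreconnected I ∧ p k ∈ I ∧ ∃ ς : ℝ → K,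
      ContinuousOn ς I ∧ (∀ w ∈ I, p (ς w) = w) ∧ ς (p k) = k) : Function.Injective p := by
  have hsep : IsSeparatedMap p := T2Space.isSeparatedMap p
  intro k₀ k₁ hk
  -- The points joined to `k₀` by one section over an open interval. This set will be clopen, hence
  -- everything; a section through `k₀` and `k₁` takes one value over `p k₀ = p k₁`.
  let R : Set K := {k | ∃ J, IsOpen J ∧ IsPreconnected J ∧ p k₀ ∈ J ∧ p k ∈ J ∧ ∃ σ : ℝ → K,
    ContinuousOn σ J ∧ (∀ w ∈ J, p (σ w) = w) ∧ σ (p k₀) = k₀ ∧ σ (p k) = k}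
  have hloc : ∀ k, ∃ V ∈ 𝓝 k, ∀ k' ∈ V, k' ∈ R → ∀ k'' ∈ V, k'' ∈ R := by
    intro k
    obtain ⟨I, hIo, hIc, hkI, ς, hςc, hςp, hςk⟩ := hsec k
    obtain ⟨N, hNo, hkN, hN⟩ := hinj k
    have hςat : ContinuousAt ς (p k) := hςc.continuousAt (hIo.mem_nhds hkI)
    have h1 : ∀ᶠ k' in 𝓝 k, ς (p k') ∈ N :=
      hp.continuousAt.eventually (hςat (hNo.mem_nhds (by rwa [hςk])))
    have h2 : ∀ᶠ k' in 𝓝 k, p k' ∈ I := hp.continuousAt (hIo.mem_nhds hkI)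
    have hV : ∀ᶠ k' in 𝓝 k, p k' ∈ I ∧ ς (p k') = k' := by
      filter_upwards [h1, h2, hNo.mem_nhds hkN] with k' a b c
      exact ⟨b, hN a c (hςp _ b)⟩
    refine ⟨_, hV, fun k' hk' hR k'' hk'' => ?_⟩
    obtain ⟨J, hJo, hJc, h0J, hkJ, σ, hσc, hσp, hσ0, hσk⟩ := hR
    -- Here the target being a line matters: the overlap of two intervals is connected, so sections
    -- that agree at one point agree on all of it and can be glued.
    have hJI : IsPreconnected (J ∩ I) := by
      rw [isPreconnected_iff_ordConnected] at hJc hIc ⊢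
      exact hJc.inter hIc
    have hagree : EqOn σ ς (J ∩ I) :=
      hsep.eqOn_of_comp_eqOn hinj hJI (hσc.mono inter_subset_left) (hςc.mono inter_subset_right)
        (fun w hw => (hσp w hw.1).trans (hςp w hw.2).symm) ⟨hkJ, hk'.1⟩ (hσk.trans hk'.2.symm)
    classical
    have eJ : EqOn (J.piecewise σ ς) σ J := fun w hw => piecewise_eq_of_mem _ _ _ hw
    have eI : EqOn (J.piecewise σ ς) ς I := fun w hw => by
      by_cases hwJ : w ∈ J
      · rw [eJ hwJ, hagree ⟨hwJ, hw⟩]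
      · exact piecewise_eq_of_notMem _ _ _ hwJ
    refine ⟨J ∪ I, hJo.union hIo, hJc.union _ hkJ hk'.1 hIc, Or.inl h0J, Or.inr hk''.1,
      J.piecewise σ ς, ?_, ?_, (eJ h0J).trans hσ0, (eI hk''.1).trans hk''.2⟩
    · exact (hσc.congr eJ).union_of_isOpen (hςc.congr eI) hJo hIo
    · rintro w (hw | hw)
      · rw [eJ hw, hσp w hw]
      · rw [eI hw, hςp w hw]
  have hclopen : IsClopen R := by
    refine ⟨⟨isOpen_iff_mem_nhds.2 fun k hk => ?_⟩, isOpen_iff_mem_nhds.2 fun k hk => ?_⟩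
    · obtain ⟨V, hV, h⟩ := hloc k
      exact mem_of_superset hV fun k' hk' hR => hk (h k' hk' hR k (mem_of_mem_nhds hV))
    · obtain ⟨V, hV, h⟩ := hloc k
      exact mem_of_superset hV (h k (mem_of_mem_nhds hV) hk)
  have h0 : k₀ ∈ R := by
    obtain ⟨I, hIo, hIc, hkI, ς, hςc, hςp, hςk⟩ := hsec k₀
    exact ⟨I, hIo, hIc, hkI, hkI, ς, hςc, hςp, hςk, hςk⟩
  have h1 : k₁ ∈ R := by rw [hclopen.eq_univ ⟨k₀, h0⟩]; trivial
  obtain ⟨J, -, -, -, -, σ, -, -, hσ0, hσ1⟩ := h1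
  rw [← hσ0, ← hσ1, hk]

/-- Near a point where `∂g/∂u²` does not vanish, a level set of `g` contains at most one point with
given first coordinate. -/
theorem exists_nhds_injOn_of_partialDeriv_ne_zero {g : Controls → ℝ} {u : Controls}
    (hg : ContDiffAt ℝ 1 g u) (hne : partialDeriv g 1 u ≠ 0) :
    ∃ N, IsOpen N ∧ u ∈ N ∧ ∀ v ∈ N, ∀ v' ∈ N, g v = g v' → v 0 = v' 0 → v = v' := by
  have hs := hg.hasStrictFDerivAt one_ne_zero
  rw [partialDeriv_eq_fderiv 1 (hg.differentiableAt one_ne_zero)] at hne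
  set c := fderiv ℝ g u (Pi.single 1 1) with hc
  -- With error constant `|c| / 2`, two points with equal values of `g` and equal first coordinates
  -- at distance d satisfy |c| d ≤ |c| d / 2, so d = 0.
  have hlo := hs.isLittleO.def (c := |c| / 2) (by positivity)
  rw [nhds_prod_eq] at hlo
  obtain ⟨S, hS, h⟩ := mem_prod_self_iff.1 hlo
  obtain ⟨N, hNS, hNo, huN⟩ := _root_.mem_nhds_iff.1 hS
  refine ⟨N, hNo, huN, fun v hv v' hv' hgv h0 => ?_⟩
  have hb : ‖g v - g v' - fderiv ℝ g u (v - v')‖ ≤ |c| / 2 * ‖v - v'‖ :=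
    h (mk_mem_prod (hNS hv) (hNS hv'))
  have hd : v - v' = (v 1 - v' 1) • (Pi.single 1 1 : Controls) := by
    funext k
    fin_cases k
    · simp [h0]
    · simp
  simp only [hgv, sub_self, zero_sub, norm_neg, hd, map_smul, norm_smul, ← hc] at hb
  have hn : ‖(Pi.single 1 1 : Controls)‖ = 1 := (Pi.norm_single (G := fun _ : Fin 2 => ℝ) (1 : ℝ)).trans norm_one
  rw [hn, Real.norm_eq_abs, Real.norm_eq_abs, mul_one] at hb
  have hcpos : 0 < |c| := abs_pos.2 hne
  have : |v 1 - v' 1| = 0 := by nlinarith [abs_nonneg (v 1 - v' 1)]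
  have h1 : v 1 = v' 1 := sub_eq_zero.1 (abs_eq_zero.1 this)
  funext k
  fin_cases k
  · exact h0
  · exact h1

/-- Local inverse of a feedback rule in the stock variable. -/
theorem exists_stock_inverse {T : ℝ} {Φ : ℝ → ℝ → ℝ}
    (hΦ : ContDiffOn ℝ 1 (fun p : ℝ × ℝ => Φ p.1 p.2) (nodes T)) {t x : ℝ} (ht : t ∈ Icc 0 T)
    (hx : 0 < x) (hne : stockDeriv T Φ t x ≠ 0) :
    ∃ (r : ℝ) (X : ℝ → ℝ), 0 < r ∧ ContinuousOn X (ball (Φ t x) r) ∧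
      (∀ w ∈ ball (Φ t x) r, 0 < X w ∧ Φ t (X w) = w) ∧ X (Φ t x) = x ∧
      HasDerivAt X (stockDeriv T Φ t x)⁻¹ (Φ t x) := by
  have hC : ContDiffAt ℝ 1 (Φ t) x := by
    have : ContDiffOn ℝ 1 (Φ t) (Ioi 0) :=
      hΦ.comp (f := fun z : ℝ => (t, z)) (contDiffOn_const.prodMk contDiffOn_id)
        fun z hz => ⟨ht, hz⟩
    exact this.contDiffAt (Ioi_mem_nhds hx)
  have hd : HasDerivAt (Φ t) (stockDeriv T Φ t x) x := hasDerivAt_stock hΦ ht hx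
  have hs : HasStrictDerivAt (Φ t) (stockDeriv T Φ t x) x := by
    have := hC.hasStrictDerivAt one_ne_zero
    rwa [hd.deriv] at this
  have hs' := hs.hasStrictFDerivAt_equiv hne
  let e := hs'.toOpenPartialHomeomorph (Φ t)
  have hxs : x ∈ e.source := hs'.mem_toOpenPartialHomeomorph_source
  have hco : ∀ z, e z = Φ t z := fun z => rfl
  -- Shrinks the domain of the local inverse so that its values are positive stocks.
  have hopen : IsOpen (e.target ∩ e.symm ⁻¹' Ioi 0) := e.isOpen_inter_preimage_symm isOpen_Ioi
  have hsx : e.symm (Φ t x) = x := e.left_inv hxs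
  have hmem : Φ t x ∈ e.target ∩ e.symm ⁻¹' Ioi 0 := by
    refine ⟨e.map_source hxs, ?_⟩
    rw [mem_preimage, hsx]
    exact hx
  obtain ⟨r, hr, hball⟩ := Metric.isOpen_iff.1 hopen _ hmem
  refine ⟨r, e.symm, hr, e.continuousOn_symm.mono fun w hw => (hball hw).1,
    fun w hw => ⟨(hball hw).2, e.right_inv (hball hw).1⟩, hsx, ?_⟩
  refine e.hasDerivAt_symm hmem.1 hne ?_
  rw [hsx]
  exact hd

theorem isPreconnected_nodes (T : ℝ) : IsPreconnected (nodes T) :=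
  ((convex_Icc 0 T).prod (convex_Ioi 0)).isPreconnected

section Graph

variable {G : AdditiveDuopoly} {M : MonopolyModel G} {φ : FeedbackProfile}

/-- In a regular rationalizing model the first rule determines the second one. -/
theorem rule_determined (hreg : M.IsRegularAlong φ) (hφ : IsAdmissible G.dynamics G.T G.U φ)
    (hopt : M.IsOptimal φ)
    (hint : ∀ i, ∀ t ∈ Icc 0 G.T, ∀ x ∈ Ioi (0 : ℝ), φ i t x ∈ interior (G.U i))
    (hux : ∀ t ∈ Icc 0 G.T, ∀ x ∈ Ioi (0 : ℝ), stockDeriv G.T (φ 0) t x ≠ 0)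
    {p q : ℝ × ℝ} (hp : p ∈ nodes G.T) (hq : q ∈ nodes G.T) (h : φ 0 p.1 p.2 = φ 0 q.1 q.2) :
    φ 1 p.1 p.2 = φ 1 q.1 q.2 := by
  let Ψ : ℝ × ℝ → Controls := fun p => φ.at p.1 p.2
  have hΨ : ContinuousOn Ψ (nodes G.T) := continuousOn_pi.2 fun k => (hφ.1 k).continuousOn
  -- The range of the profile: a connected subset of the zero set of the gap. Regularity makes its
  -- first projection locally injective.
  let K : Set Controls := Ψ '' nodes G.T
  have hK : IsPreconnected K := (isPreconnected_nodes G.T).image Ψ hΨ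
  have : PreconnectedSpace K := isPreconnected_iff_preconnectedSpace.1 hK
  let π : K → ℝ := fun k => k.1 0
  have hπ : Continuous π := (continuous_apply (0 : Fin 2)).comp continuous_subtype_val
  have hgap : ∀ k : K, M.gap k.1 = 0 := by
    rintro ⟨_, d, hd, rfl⟩
    exact gap_eq_zero hreg hφ hopt hint hd.1 hd.2
  have hinj : IsLocallyInjective π := by
    rintro ⟨_, d, hd, rfl⟩
    obtain ⟨N, hNo, hN, hNi⟩ := exists_nhds_injOn_of_partialDeriv_ne_zero
      (contDiffAt_gap hreg hint hd.1 hd.2) (hreg d.1 hd.1 d.2 hd.2).2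
    refine ⟨Subtype.val ⁻¹' N, hNo.preimage continuous_subtype_val, hN, fun k hk k' hk' he => ?_⟩
    exact Subtype.ext (hNi k.1 hk k'.1 hk' ((hgap k).trans (hgap k').symm) he)
  have hsec : ∀ k, ∃ I, IsOpen I ∧ IsPreconnected I ∧ π k ∈ I ∧ ∃ ς : ℝ → K,
      ContinuousOn ς I ∧ (∀ w ∈ I, π (ς w) = w) ∧ ς (π k) = k := by
    rintro ⟨_, ⟨t, x⟩, hd, rfl⟩
    obtain ⟨r, X, hr, hXc, hX, hXx, -⟩ := exists_stock_inverse (hφ.1 0) hd.1 hd.2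
      (hux t hd.1 x hd.2)
    classical
    -- Time is frozen at `t` and the first rule is inverted in the stock. The second branch is a
    -- default value, never used on the ball.
    let ς : ℝ → K := fun w => if hw : 0 < X w then ⟨Ψ (t, X w), (t, X w), ⟨hd.1, hw⟩, rfl⟩
      else ⟨Ψ (t, x), (t, x), hd, rfl⟩
    have hς : ∀ w ∈ ball (φ 0 t x) r, (ς w).1 = Ψ (t, X w) := fun w hw => by
      simp only [ς, dif_pos (hX w hw).1]
    refine ⟨ball (φ 0 t x) r, isOpen_ball, (convex_ball _ _).isPreconnected, mem_ball_self hr, ς,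
      ?_, fun w hw => ?_, ?_⟩
    · rw [Topology.IsInducing.subtypeVal.continuousOn_iff]
      refine ContinuousOn.congr ?_ hς
      exact hΨ.comp (continuousOn_const.prodMk hXc) fun w hw => ⟨hd.1, (hX w hw).1⟩
    · show (ς w).1 0 = w
      rw [hς w hw]
      exact (hX w hw).2
    · refine Subtype.ext ?_
      show (ς (φ 0 t x)).1 = Ψ (t, x)
      rw [hς _ (mem_ball_self hr), hXx]
  have := injective_of_local_sections hπ hinj hsec (a₁ := ⟨Ψ p, p, hp, rfl⟩)
    (a₂ := ⟨Ψ q, q, hq, rfl⟩) h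
  exact congrFun (congrArg Subtype.val this) 1

/-- By `rule_determined` any choice of a node with the given value of the first rule gives the same
θ. Near `φ 0 t x` it is `φ 1 t` composed with the local inverse of `φ 0 t`, so its two-sided
derivative is the quotient of the stock derivatives. -/
theorem exists_rule_graph (hreg : M.IsRegularAlong φ) (hφ : IsAdmissible G.dynamics G.T G.U φ)
    (hopt : M.IsOptimal φ)
    (hint : ∀ i, ∀ t ∈ Icc 0 G.T, ∀ x ∈ Ioi (0 : ℝ), φ i t x ∈ interior (G.U i))
    (hux : ∀ t ∈ Icc 0 G.T, ∀ x ∈ Ioi (0 : ℝ), stockDeriv G.T (φ 0) t x ≠ 0) :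
    ∃ θ : ℝ → ℝ, ∀ t ∈ Icc 0 G.T, ∀ x ∈ Ioi (0 : ℝ), φ 1 t x = θ (φ 0 t x) ∧
      HasDerivAt θ (ruleSlope G.T φ t x) (φ 0 t x) := by
  classical
  let θ : ℝ → ℝ := fun w =>
    if h : ∃ p ∈ nodes G.T, φ 0 p.1 p.2 = w then φ 1 h.choose.1 h.choose.2 else 0
  have hθ : ∀ t ∈ Icc 0 G.T, ∀ x ∈ Ioi (0 : ℝ), φ 1 t x = θ (φ 0 t x) := by
    intro t ht x hx
    have h : ∃ p ∈ nodes G.T, φ 0 p.1 p.2 = φ 0 t x := ⟨(t, x), ⟨ht, hx⟩, rfl⟩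
    simp only [θ, dif_pos h]
    exact rule_determined hreg hφ hopt hint hux (p := (t, x)) ⟨ht, hx⟩ h.choose_spec.1
      h.choose_spec.2.symm
  refine ⟨θ, fun t ht x hx => ⟨hθ t ht x hx, ?_⟩⟩
  obtain ⟨r, X, hr, -, hX, hXx, hXd⟩ := exists_stock_inverse (hφ.1 0) ht hx (hux t ht x hx)
  have h1 : HasDerivAt (φ 1 t) (stockDeriv G.T (φ 1) t x) (X (φ 0 t x)) := by
    rw [hXx]
    exact hasDerivAt_stock (hφ.1 1) ht hx
  refine (h1.comp _ hXd).congr_of_eventuallyEq ?_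
  filter_upwards [ball_mem_nhds (φ 0 t x) hr] with w hw
  rw [Function.comp_apply, hθ t ht _ (hX w hw).1, (hX w hw).2]

end Graph

/-! ### Constant signs, inverse marginal utilities and the conclusion. -/

theorem exists_sign_of_ne_zero {S : Set (ℝ × ℝ)} (hS : IsPreconnected S) {f : ℝ × ℝ → ℝ}
    (hf : ContinuousOn f S) (hne : ∀ p ∈ S, f p ≠ 0) :
    ∃ σ : ℝ, (σ = 1 ∨ σ = -1) ∧ ∀ p ∈ S, f p = σ * |f p| := by
  by_cases h : ∃ p ∈ S, f p < 0
  · obtain ⟨p, hp, hpn⟩ := h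
    refine ⟨-1, Or.inr rfl, fun q hq => ?_⟩
    have : f q < 0 := by
      by_contra hc
      obtain ⟨r, hr, hr0⟩ := hS.intermediate_value hp hq hf ⟨hpn.le, not_lt.1 hc⟩
      exact hne r hr hr0
    rw [abs_of_neg this]
    ring
  · push Not at h
    exact ⟨1, Or.inl rfl, fun q hq => by rw [abs_of_nonneg (h q hq), one_mul]⟩

theorem continuousOn_E_sub_Eext (G : AdditiveDuopoly) (φ : FeedbackProfile)
    (hφC : ∀ i, ContDiffOn ℝ 1 (fun p : ℝ × ℝ => φ i p.1 p.2) (nodes G.T))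
    (hint : ∀ i, ∀ t ∈ Icc 0 G.T, ∀ x ∈ Ioi (0 : ℝ), φ i t x ∈ interior (G.U i)) (i : Fin 2) :
    ContinuousOn (fun p : ℝ × ℝ => G.E i (φ.at p.1 p.2) - G.Eext i (φ.at p.1 p.2))
      (nodes G.T) := by
  have hcomp : ∀ {f : ℝ → ℝ} (k : Fin 2), (∀ w ∈ interior (G.U k), ContinuousAt f w) →
      ContinuousOn (fun p : ℝ × ℝ => f (φ k p.1 p.2)) (nodes G.T) := fun k hf q hq =>
    (hf _ (hint k q.1 hq.1 q.2 hq.2)).comp_continuousWithinAt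
      (f := fun p : ℝ × ℝ => φ k p.1 p.2) ((hφC k).continuousOn q hq)
  have h1 := hcomp i fun w hw => (contDiffAt_deriv (contDiffAt_own G i hw)).continuousAt
  have h2 := hcomp (1 - i) fun w hw => (contDiffAt_deriv (contDiffAt_ext G i hw)).continuousAt
  have h3 := hcomp i fun w hw =>
    ((contDiffAt_deriv (contDiffAt_own G i hw)).derivWithin (m := 0) (by simp)).continuousAt
  have hne : ∀ p ∈ nodes G.T, deriv (deriv (G.own i)) (φ i p.1 p.2) ≠ 0 := fun p hp =>
    (G.own_concave i _ (hint i p.1 hp.1 p.2 hp.2)).ne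
  exact ((h1.div h3 hne).neg).sub ((h2.div h3 hne).neg)

/-- Strict concavity makes marginal utility strictly decreasing on the interior of an interval, so
the chosen preimage is the only one. -/
theorem marginalInv_deriv_own (G : AdditiveDuopoly) (i : Fin 2) {w : ℝ}
    (hw : w ∈ interior (G.U i)) : G.marginalInv i (deriv (G.own i) w) = w := by
  have hanti : StrictAntiOn (deriv (G.own i)) (interior (G.U i)) := by
    refine strictAntiOn_of_deriv_neg (G.convex_U i).interior (fun w hw => ?_) fun w hw => ?_
    · exact (contDiffAt_deriv (contDiffAt_own G i hw)).continuousAt.continuousWithinAt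
    · rw [interior_interior] at hw
      exact G.own_concave i w hw
  exact hanti.injOn.leftInvOn_invFunOn hw

theorem FeedbackProfile.at_eq_vec (φ : FeedbackProfile) (t x : ℝ) :
    φ.at t x = ![φ 0 t x, φ 1 t x] := by
  funext k
  fin_cases k <;> rfl

section

variable {G : AdditiveDuopoly} {M : MonopolyModel G} {φ : FeedbackProfile}

/-- Substituting e_2 = e_1 τ² exhibits the product as a square: the source of both the inequality in
(a) and the impossibility in (b). -/
theorem product_eq_sq (hreg : M.IsRegularAlong φ) (hφ : G.IsMPNE φ) (hopt : M.IsOptimal φ)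
    (hint : ∀ i, ∀ t ∈ Icc 0 G.T, ∀ x ∈ Ioi (0 : ℝ), φ i t x ∈ interior (G.U i))
    (hux : ∀ t ∈ Icc 0 G.T, ∀ x ∈ Ioi (0 : ℝ), stockDeriv G.T (φ 0) t x ≠ 0)
    {t x : ℝ} (ht : t ∈ Icc 0 G.T) (hx : 0 < x) :
    G.product (φ.at t x) =
      ((G.E 0 (φ.at t x) - G.Eext 0 (φ.at t x)) * ruleSlope G.T φ t x) ^ 2 := by
  have h := (slope_relations hreg hφ hopt hint ht hx (hux t ht x hx)).1
  unfold AdditiveDuopoly.product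
  rw [← h]
  ring

/-- A strictly positive product makes e_1 τ nonzero, hence also e_1 and τ. Being continuous on a
connected set, τ and e_1 τ keep their signs, which supplies the sign of the equation for θ and that
of the formula for f respectively. -/
theorem rationalized_structure (hreg : M.IsRegularAlong φ) (hφ : G.IsMPNE φ)
    (hopt : M.IsOptimal φ)
    (hint : ∀ i, ∀ t ∈ Icc 0 G.T, ∀ x ∈ Ioi (0 : ℝ), φ i t x ∈ interior (G.U i))
    (hux : ∀ t ∈ Icc 0 G.T, ∀ x ∈ Ioi (0 : ℝ), stockDeriv G.T (φ 0) t x ≠ 0)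
    (hprod : ∀ t ∈ Icc 0 G.T, ∀ x ∈ Ioi (0 : ℝ), 0 < G.product (φ.at t x)) :
    ∃ θ : ℝ → ℝ,
      (∀ t ∈ Icc 0 G.T, ∀ x ∈ Ioi (0 : ℝ), φ 1 t x = θ (φ 0 t x)) ∧
      (∃ σ : ℝ, (σ = 1 ∨ σ = -1) ∧
        ∀ t ∈ Icc 0 G.T, ∀ x ∈ Ioi (0 : ℝ), ∀ w : ℝ, w = φ 0 t x →
          HasDerivAt θ
            (σ * (√|G.E 1 ![w, θ w] - G.Eext 1 ![w, θ w]| /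
              √|G.E 0 ![w, θ w] - G.Eext 0 ![w, θ w]|)) w) ∧
      (∃ σ : ℝ, (σ = 1 ∨ σ = -1) ∧
        ∀ t ∈ Icc 0 G.T, ∀ x ∈ Ioi (0 : ℝ),
          deriv (fun y => M.costate 0 (φ.at t y)) x ≠ 0 →
          M.dynamics (φ.at t x) = G.dynamics (φ.at t x) + σ * √(G.product (φ.at t x))) ∧
      (∀ x ∈ Ioi (0 : ℝ),
        (∀ i, deriv (G.bequest i) x ∈ deriv (G.own i) '' interior (G.U i)) ∧
        G.marginalInv 1 (deriv (G.bequest 1) x) =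
          θ (G.marginalInv 0 (deriv (G.bequest 0) x))) := by
  have hT := G.T_pos
  have hφC := hφ.1.1
  obtain ⟨θ, hθ⟩ := exists_rule_graph hreg hφ.1 hopt hint hux
  let e : Fin 2 → ℝ → ℝ → ℝ := fun i t x => G.E i (φ.at t x) - G.Eext i (φ.at t x)
  have hrel : ∀ t ∈ Icc 0 G.T, ∀ x ∈ Ioi (0 : ℝ), e 0 t x * ruleSlope G.T φ t x ^ 2 = e 1 t x :=
    fun t ht x hx => (slope_relations hreg hφ hopt hint ht hx (hux t ht x hx)).1
  have hsq := fun t (ht : t ∈ Icc 0 G.T) x (hx : x ∈ Ioi (0 : ℝ)) =>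
    product_eq_sq hreg hφ hopt hint hux ht hx
  have hne : ∀ t ∈ Icc 0 G.T, ∀ x ∈ Ioi (0 : ℝ), e 0 t x * ruleSlope G.T φ t x ≠ 0 := by
    intro t ht x hx h0
    have := hprod t ht x hx
    rw [hsq t ht x hx] at this
    simp only [e] at h0
    rw [h0] at this
    simp at this
  have hslope : ContinuousOn (fun p : ℝ × ℝ => ruleSlope G.T φ p.1 p.2) (nodes G.T) :=
    (continuousOn_stockDeriv hT (hφC 1)).div (continuousOn_stockDeriv hT (hφC 0))
      fun p hp => hux p.1 hp.1 p.2 hp.2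
  refine ⟨θ, fun t ht x hx => (hθ t ht x hx).1, ?_, ?_, fun x hx => ⟨fun i => ?_, ?_⟩⟩
  · obtain ⟨σ, hσ, hsgn⟩ := exists_sign_of_ne_zero (isPreconnected_nodes G.T) hslope
      fun p hp => right_ne_zero_of_mul (hne p.1 hp.1 p.2 hp.2)
    refine ⟨σ, hσ, ?_⟩
    rintro t ht x hx _ rfl
    rw [← (hθ t ht x hx).1, ← φ.at_eq_vec]
    convert (hθ t ht x hx).2 using 1
    have h0 : e 0 t x ≠ 0 := left_ne_zero_of_mul (hne t ht x hx)
    have hs := hsgn (t, x) ⟨ht, hx⟩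
    simp only at hs
    rw [hs, ← Real.sqrt_div (abs_nonneg _)]
    show σ * √(|e 1 t x| / |e 0 t x|) = _
    -- The quotient |e_2| / |e_1| is τ², whose square root is |τ|.
    rw [← hrel t ht x hx, abs_mul, mul_div_cancel_left₀ _ (abs_ne_zero.2 h0), abs_sq,
      Real.sqrt_sq_eq_abs]
  · obtain ⟨σ, hσ, hsgn⟩ := exists_sign_of_ne_zero (isPreconnected_nodes G.T)
      ((continuousOn_E_sub_Eext G φ hφC hint 0).mul hslope)
      fun p hp => hne p.1 hp.1 p.2 hp.2
    refine ⟨σ, hσ, fun t ht x hx hd => ?_⟩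
    have hd' := hasDerivAt_stock (Φ := fun t x => M.costate 0 (φ.at t x))
      (contDiffOn_costate hreg hφC hint 0) ht hx
    rw [hd'.deriv] at hd
    rw [(slope_relations hreg hφ hopt hint ht hx (hux t ht x hx)).2 hd, hsq t ht x hx,
      Real.sqrt_sq_eq_abs]
    congr 1
    exact hsgn (t, x) ⟨ht, hx⟩
  · exact ⟨φ i G.T x, hint i G.T ⟨hT.le, le_rfl⟩ x hx, transversality G φ hφ hint i hx⟩
  -- At the horizon, transversality and the inverse marginal utilities turn the marginal bequests
  -- back into the controls, so the identity is u² = θ(u¹) at `t = T`.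
  · have hTT : G.T ∈ Icc 0 G.T := ⟨hT.le, le_rfl⟩
    rw [← transversality G φ hφ hint 0 hx, ← transversality G φ hφ hint 1 hx,
      marginalInv_deriv_own G 0 (hint 0 G.T hTT x hx),
      marginalInv_deriv_own G 1 (hint 1 G.T hTT x hx)]
    exact (hθ G.T hTT x hx).1

end

theorem mainTheorem3 (G : AdditiveDuopoly) (φ : FeedbackProfile)
    (hφ : G.IsMPNE φ)
    (hint : ∀ i, ∀ t ∈ Icc 0 G.T, ∀ x ∈ Ioi (0 : ℝ), φ i t x ∈ interior (G.U i))
    (hux : ∀ t ∈ Icc 0 G.T, ∀ x ∈ Ioi (0 : ℝ), deriv (fun y => φ 0 t y) x ≠ 0) :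
    (∀ M : MonopolyModel G, M.IsRegularAlong φ → M.Rationalizes φ →
      (∀ t ∈ Icc 0 G.T, ∀ x ∈ Ioi (0 : ℝ), 0 ≤ G.product (φ.at t x)) ∧
      ((∀ t ∈ Icc 0 G.T, ∀ x ∈ Ioi (0 : ℝ), 0 < G.product (φ.at t x)) →
        ∃ θ : ℝ → ℝ,
          (∀ t ∈ Icc 0 G.T, ∀ x ∈ Ioi (0 : ℝ), φ 1 t x = θ (φ 0 t x)) ∧
          (∃ σ : ℝ, (σ = 1 ∨ σ = -1) ∧
            ∀ t ∈ Icc 0 G.T, ∀ x ∈ Ioi (0 : ℝ), ∀ w : ℝ, w = φ 0 t x →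
              HasDerivAt θ
                (σ * (√|G.E 1 ![w, θ w] - G.Eext 1 ![w, θ w]| /
                  √|G.E 0 ![w, θ w] - G.Eext 0 ![w, θ w]|)) w) ∧
          (∃ σ : ℝ, (σ = 1 ∨ σ = -1) ∧
            ∀ t ∈ Icc 0 G.T, ∀ x ∈ Ioi (0 : ℝ),
              deriv (fun y => M.costate 0 (φ.at t y)) x ≠ 0 →
              M.dynamics (φ.at t x) = G.dynamics (φ.at t x) + σ * √(G.product (φ.at t x))) ∧
          (∀ x ∈ Ioi (0 : ℝ),
            (∀ i, deriv (G.bequest i) x ∈ deriv (G.own i) '' interior (G.U i)) ∧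
            G.marginalInv 1 (deriv (G.bequest 1) x) =
              θ (G.marginalInv 0 (deriv (G.bequest 0) x))))) ∧
    ((∃ t ∈ Icc 0 G.T, ∃ x ∈ Ioi (0 : ℝ), G.product (φ.at t x) < 0) →
      ¬ ∃ M : MonopolyModel G, M.IsRegularAlong φ ∧ M.Rationalizes φ) := by
  have hux' : ∀ t ∈ Icc 0 G.T, ∀ x ∈ Ioi (0 : ℝ), stockDeriv G.T (φ 0) t x ≠ 0 :=
    fun t ht x hx => by
      rw [← (hasDerivAt_stock (hφ.1.1 0) ht hx).deriv]
      exact hux t ht x hx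
  have hnonneg : ∀ M : MonopolyModel G, M.IsRegularAlong φ → M.Rationalizes φ →
      ∀ t ∈ Icc 0 G.T, ∀ x ∈ Ioi (0 : ℝ), 0 ≤ G.product (φ.at t x) :=
    fun M hreg hrat t ht x hx => by
      rw [product_eq_sq hreg hφ hrat.2 hint hux' ht hx]
      exact sq_nonneg _
  refine ⟨fun M hreg hrat => ⟨hnonneg M hreg hrat, fun hprod =>
    rationalized_structure hreg hφ hrat.2 hint hux' hprod⟩, ?_⟩
  rintro ⟨t, ht, x, hx, hneg⟩ ⟨M, hreg, hrat⟩
  exact absurd (hnonneg M hreg hrat t ht x hx) (not_le.2 hneg)
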